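/- Let $M$ be a closed orientable $4$-manifold with a (possibly singular) triangulation $\mathcal T$ consisting of $n$ pentachora: $n$ disjoint oriented $4$-simplices whose facets are identified in pairs of distinct facets by orientation-reversing affine isomorphisms, together with a homeomorphism (PL if $M$ is given a PL structure) from the quotient space $|\mathcal T|$ onto $M$. Let $\{P_0,P_1,P_2\}$ be a tricoloring of $\mathcal T$, that is, a partition of the vertices of $\mathcal T$ such that every pentachoron has two vertices in each of two of the sets and one vertex in the remaining set. Let $\Delta^2$ be a $2$-simplex with vertices $v_0,v_1,v_2$ and let $\mu\colon M\to\Delta^2$ be the map that sends the vertices in $P_k$ to $v_k$ and is affine on each pentachoron. Assume that the tricoloring is a ts-tricoloring, that is: 1. for each $k$ the graph $\Gamma_k=\mu^{-1}(v_k)$ is connected, and 2. for each edge $e$ of $\Delta^2$, the preimage under $\mu$ of the segment from the barycenter of $\Delta^2$ to the midpoint of $e$ collapses (in the PL sense) onto a spine of dimension at most one. Then the genus of the central surface $\Sigma=\mu^{-1}(\text{barycenter of }\Delta^2)\subset M$ of the induced trisection, i.e. half the rank of $H_1(\Sigma;\mathbb Z)$, is at most $n/2$. -/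

import Mathlib

noncomputable section

/-- An oriented singular triangulation with `n` pentachora: `n` copies of the standard 4-simplex,
each with an orientation `ori i` (a sign relative to the order of its vertices `0, …, 4`), whose
facets are paired by orientation-reversing affine isomorphisms.

The facet of the pentachoron `i` opposite to the vertex `a` is glued to the facet of the
pentachoron `nbr i a` opposite to the vertex `glue i a a`; a vertex `k ≠ a` of the first facet is
sent to the vertex `glue i a k` of the second one. -/
structure SingularTriangulation (n : ℕ) where
  ori : Fin n → ℤˣ
  nbr : Fin n → Fin 5 → Fin n
  glue : Fin n → Fin 5 → Equiv.Perm (Fin 5)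
  /-- The inverse of a face pairing is a face pairing. -/
  nbr_nbr : ∀ i a, nbr (nbr i a) (glue i a a) = i
  glue_glue : ∀ i a, glue (nbr i a) (glue i a a) = (glue i a)⁻¹
  /-- Face pairings identify distinct facets. -/
  ne_self : ∀ i a, (nbr i a, glue i a a) ≠ (i, a)
  /-- Face pairings reverse the orientations that the facets inherit from their pentachora. The
  affine isomorphism of pentachora that extends a face pairing according to `glue i a` matches
  outward normals with outward normals, so this says that it reverses the orientations of the
  pentachora. -/
  ori_rev : ∀ i a, ori (nbr i a) * Equiv.Perm.sign (glue i a) * ori i = -1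

namespace SingularTriangulation

variable {n : ℕ} (T : SingularTriangulation n)

/-- Identification of vertices of pentachora by the face pairings. -/
def VertexRel (v w : Fin n × Fin 5) : Prop :=
  ∃ a, v.2 ≠ a ∧ w = (T.nbr v.1 a, T.glue v.1 a v.2)

/-- The (singular) vertices of the triangulation. -/
abbrev Vertex : Type := Quot T.VertexRel

/-- The disjoint union of the pentachora, points being given in barycentric coordinates. -/
abbrev Pentachora (n : ℕ) : Type := Σ _ : Fin n, stdSimplex ℝ (Fin 5)

/-- Identification of points of pentachora by the face pairings. -/
def PointRel (p q : Pentachora n) : Prop :=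
  ∃ a, (p.2 : Fin 5 → ℝ) a = 0 ∧ q.1 = T.nbr p.1 a ∧
    ∀ k, (q.2 : Fin 5 → ℝ) (T.glue p.1 a k) = (p.2 : Fin 5 → ℝ) k

/-- The quotient space of the disjoint union of the pentachora by the face pairings, with the
quotient topology. -/
abbrev Realization : Type := Quot T.PointRel

/-- The quotient map. -/
def proj (p : Pentachora n) : T.Realization := Quot.mk _ p

/-- A tricoloring: a partition `P 0, P 1, P 2` of the vertices of the triangulation, given by the
map `color` that is equal to `k` on `P k`, such that every pentachoron has one vertex in one of
the partition sets and two vertices in each of the other two. -/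
structure Tricoloring where
  color : T.Vertex → Fin 3
  two_two_one : ∀ i : Fin n, ∃ c : Fin 3,
    (Finset.univ.filter fun k : Fin 5 => color (Quot.mk _ (i, k)) = c).card = 1 ∧
    ∀ c' : Fin 3, c' ≠ c →
      (Finset.univ.filter fun k : Fin 5 => color (Quot.mk _ (i, k)) = c').card = 2

/-- An elementary simplicial collapse of the set of simplices `F` to `G`: a simplex `s` and a face
`t` of codimension one of `s` that is properly contained in no other simplex are removed. -/
def ElementaryCollapse {E : Type*} (F G : Set (Finset E)) : Prop :=
  ∃ s ∈ F, ∃ t ∈ F, t ⊂ s ∧ s.card = t.card + 1 ∧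
    (∀ u ∈ F, t ⊂ u → u = s) ∧ G = F \ {s, t}

/-- A subset `X` of the realization (PL-)collapses onto a spine of dimension at most one: there
are a finite simplicial complex `K` in a Euclidean space and a homeomorphism `f` from the
underlying space of `K` onto `X`, mapping each simplex of `K` affinely into some pentachoron,
such that `K` collapses to a subcomplex `L` all of whose simplices have at most two vertices. -/
def HasGraphSpine (X : Set T.Realization) : Prop :=
  ∃ (N : ℕ) (K : Geometry.SimplicialComplex ℝ (EuclideanSpace ℝ (Fin N)))
    (f : EuclideanSpace ℝ (Fin N) → T.Realization) (L : Set (Finset (EuclideanSpace ℝ (Fin N)))),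
    K.faces.Finite ∧ Set.BijOn f K.space X ∧
    (∀ s ∈ K.faces, ∃ (i : Fin n) (A : EuclideanSpace ℝ (Fin N) →ᵃ[ℝ] (Fin 5 → ℝ)),
      ∀ x ∈ convexHull ℝ (s : Set (EuclideanSpace ℝ (Fin N))),
        ∃ hx : A x ∈ stdSimplex ℝ (Fin 5), f x = T.proj ⟨i, ⟨A x, hx⟩⟩) ∧
    Relation.ReflTransGen ElementaryCollapse K.faces L ∧
    ∀ s ∈ L, s.card ≤ 2

namespace Tricoloring

variable {T} (P : T.Tricoloring)

/-- The map from the realization to the 2-simplex in `ℝ³` that sends the vertices in `P k` to the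
`k`-th vertex and is affine on each pentachoron. -/
def toTriangle : T.Realization → (Fin 3 → ℝ) :=
  Quot.lift
    (fun p c => ∑ k : Fin 5,
      if P.color (Quot.mk _ (p.1, k)) = c then (p.2 : Fin 5 → ℝ) k else 0)
    (by
      rintro ⟨i, x⟩ ⟨j, y⟩ ⟨a, ha, hj, hy⟩
      dsimp only at ha hj hy ⊢
      subst hj
      funext c
      rw [← Equiv.sum_comp (T.glue i a)
        (fun k => if P.color (Quot.mk _ (T.nbr i a, k)) = c then (y : Fin 5 → ℝ) k else 0)]
      refine Finset.sum_congr rfl fun k _ => ?_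
      by_cases hk : k = a
      · subst hk
        simp [hy, ha]
      · have h : (Quot.mk _ (i, k) : T.Vertex) = Quot.mk _ (T.nbr i a, T.glue i a k) :=
          Quot.sound ⟨a, hk, rfl⟩
        rw [h, hy])

/-- The barycenter of the 2-simplex. -/
def barycenter : Fin 3 → ℝ := fun _ => 1 / 3

/-- The barycenter of the edge of the 2-simplex opposite to the vertex `k`. -/
def edgeMidpoint (k : Fin 3) : Fin 3 → ℝ := fun c => if c = k then 0 else 1 / 2

/-- The monochromatic graph spanned by the vertices in `P k`: the preimage of the `k`-th vertex. -/
def monoGraph (k : Fin 3) : Set T.Realization := P.toTriangle ⁻¹' {Pi.single k 1}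

/-- The preimage of an interior 1-cube of the dual cubical structure of the 2-simplex, which is
the segment from the barycenter to the barycenter of an edge. -/
def threePiece (k : Fin 3) : Set T.Realization :=
  P.toTriangle ⁻¹' segment ℝ barycenter (edgeMidpoint k)

/-- The central surface: the preimage of the barycenter. -/
def centralSurface : Set T.Realization := P.toTriangle ⁻¹' {barycenter}

/-- A c-tricoloring has connected monochromatic graphs. -/
def IsC : Prop := ∀ k, IsConnected (P.monoGraph k)

/-- A ts-tricoloring is a c-tricoloring such that the preimage of each interior 1-cube collapses
onto a 1-dimensional spine. -/
def IsTS : Prop := P.IsC ∧ ∀ k, T.HasGraphSpine (P.threePiece k)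

end Tricoloring

end SingularTriangulation

/-- The genus of a closed connected orientable surface `S`: half of the rank of its first integral
homology group, which is the abelianized fundamental group (at any base point `x`; the fundamental
group only sees the path component of `x`, which is all of `S` if `S` is connected). -/
def surfaceGenus (S : Type*) [TopologicalSpace S] (x : S) : ℚ :=
  (Module.finrank ℤ (Additive (Abelianization (FundamentalGroup S x))) : ℚ) / 2

end

/-! Each pentachoron meets the central surface in one square, the product of two segments, whose
sides lie in the facets opposite to the four vertices of the repeated colors. So the surface is made
of `n` squares glued along `2n` edges. If it is connected with `v` vertices, its Euler
characteristic is `v - n`, the rank of its first homology is `n + 2 - v`, and the bound says that `v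
≥ 2`.

That there is more than one vertex is a parity argument. The `5n` facets are paired, so `n` is even.
Orientability gives a coherent rotation `σ` of the sides, a 4-cycle in each square, so `σ` is even.
The pairing `α` of the `4n` sides consists of `2n` transpositions and is even. The orbits of `σ * α`
are the vertices, and a single orbit would be a `4n`-cycle, which is odd
(`exists_invariant_ssubset`, `exists_vertex_sides`).

The Euler characteristic enters as a dimension estimate. A linear form on rational homology,
together with a function on the squares of a component vanishing at a base square, gives an
antisymmetric function on the sides. This map is injective (`injective_dualCochain`), because a
class whose cochain on the dual graph is a coboundary vanishes on all loops (`exists_primitive`).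
With `c` squares in the component, the rank plus `c - 1` is therefore at most `2c`. If `c < n`, this
suffices. If `c = n`, summation over a proper set of vertices gives one further independent linear
condition (`sum_dualCochain_eq_zero`). -/

noncomputable section

/-! ### Path cocycles and their primitives. -/

open scoped unitInterval

/-- An additive homotopy-invariant function on the paths of a space. -/
structure PathCocycle (X : Type*) [TopologicalSpace X] (B : Type*) [AddCommGroup B] where
  toFun : ∀ {a b : X}, Path a b → B
  map_trans : ∀ {a b c : X} (γ : Path a b) (δ : Path b c),
    toFun (γ.trans δ) = toFun γ + toFun δ
  map_homotopic : ∀ {a b : X} {γ δ : Path a b}, γ.Homotopic δ → toFun γ = toFun δ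

namespace PathCocycle

variable {X : Type*} [TopologicalSpace X] {B : Type*} [AddCommGroup B] (F : PathCocycle X B)

theorem map_refl (a : X) : F.toFun (Path.refl a) = 0 := by
  have h := F.map_trans (Path.refl a) (Path.refl a)
  rw [Path.refl_trans_refl] at h
  simpa using h

/-- Endpoints need only agree as a consequence of the pointwise equality, which avoids casts between
path types. -/
theorem congr {a b a' b' : X} {γ : Path a b} {γ' : Path a' b'} (h : ∀ t, γ t = γ' t) :
    F.toFun γ = F.toFun γ' := by
  obtain rfl : a = a' := by simpa using h 0
  obtain rfl : b = b' := by simpa using h 1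
  obtain rfl : γ = γ' := Path.ext (funext h)
  rfl

theorem eq_zero_of_const {a b y : X} {γ : Path a b} (h : ∀ t, γ t = y) : F.toFun γ = 0 :=
  (F.congr (γ' := Path.refl y) h).trans (F.map_refl y)

section Integral

variable {K : Type*} [TopologicalSpace K] [SimplyConnectedSpace K] (f : C(K, X))

/-- The value of a path cocycle on the image of any path from `z` to `w` in a simply connected
space. -/
def integral (z w : K) : B := F.toFun ((PathConnectedSpace.somePath z w).map f.continuous)

theorem map_eq_integral {z w : K} (γ : Path z w) :
    F.toFun (γ.map f.continuous) = F.integral f z w :=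
  F.map_homotopic ((SimplyConnectedSpace.paths_homotopic γ _).map f)

theorem integral_add (z w u : K) :
    F.integral f z w + F.integral f w u = F.integral f z u := by
  rw [← F.map_eq_integral f ((PathConnectedSpace.somePath z w).trans
    (PathConnectedSpace.somePath w u)), Path.map_trans, F.map_trans]
  rfl

theorem integral_self (z : K) : F.integral f z z = 0 := by
  simpa using F.integral_add f z z z

theorem integral_neg (z w : K) : -F.integral f z w = F.integral f w z := by
  rw [neg_eq_iff_add_eq_zero, integral_add, integral_self]

theorem integral_congr {K' : Type*} [TopologicalSpace K'] [SimplyConnectedSpace K'] {f' : C(K', X)}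
    {z w : K} {z' w' : K'} (γ : Path z w) (γ' : Path z' w') (h : ∀ t, f (γ t) = f' (γ' t)) :
    F.integral f z w = F.integral f' z' w' := by
  rw [← F.map_eq_integral f γ, ← F.map_eq_integral f' γ']
  exact F.congr h

end Integral

instance : ContractibleSpace I := (convex_Icc (0 : ℝ) 1).contractibleSpace ⟨0, by simp⟩

/-- The identity as a path in the unit interval. -/
def idPath : Path (0 : I) 1 := ⟨ContinuousMap.id I, rfl, rfl⟩

theorem eq_integral {a b : X} (γ : Path a b) :
    F.toFun γ = F.integral γ.toContinuousMap 0 1 := by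
  rw [← F.map_eq_integral γ.toContinuousMap idPath]
  exact F.congr fun t => rfl

/-- A path cocycle that locally is the difference of the values of a function is so globally. -/
theorem eq_sub_of_locally (ψ : X → B)
    (h : ∀ y, ∃ U ∈ nhds y, ∀ {a b : X} (γ : Path a b), (∀ t, γ t ∈ U) →
      F.toFun γ = ψ b - ψ a) {a b : X} (γ : Path a b) : F.toFun γ = ψ b - ψ a := by
  -- Along the path, the integral up to time `t` minus `ψ (γ t)` is locally constant, hence constant
  -- on the interval.
  have key : IsLocallyConstant
      (fun t : I => F.integral γ.toContinuousMap 0 t - ψ (γ t)) := by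
    rw [IsLocallyConstant.iff_eventually_eq]
    intro s
    obtain ⟨U, hU, hF⟩ := h (γ s)
    obtain ⟨ε, hε, hball⟩ := Metric.mem_nhds_iff.1 (γ.continuous.continuousAt.preimage_mem_nhds hU)
    filter_upwards [Metric.ball_mem_nhds s hε] with t ht
    have hcc := ((convex_ball (s : ℝ) ε).inter (convex_Icc (0 : ℝ) 1))
    have hs : (s : ℝ) ∈ Metric.ball (s : ℝ) ε ∩ Set.Icc 0 1 := ⟨Metric.mem_ball_self hε, s.2⟩
    have ht' : (t : ℝ) ∈ Metric.ball (s : ℝ) ε ∩ Set.Icc 0 1 := ⟨ht, t.2⟩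
    have hmem : ∀ r : I, AffineMap.lineMap (s : ℝ) (t : ℝ) (r : ℝ) ∈
        Metric.ball (s : ℝ) ε ∩ Set.Icc 0 1 := fun r =>
      hcc.segment_subset hs ht' (by
        rw [segment_eq_image_lineMap]; exact ⟨r, r.2, rfl⟩)
    let p : Path s t :=
      { toFun := fun r => ⟨AffineMap.lineMap (s : ℝ) (t : ℝ) (r : ℝ), (hmem r).2⟩
        continuous_toFun := by
          refine Continuous.subtype_mk ?_ _
          exact AffineMap.lineMap_continuous.comp continuous_subtype_val
        source' := by ext; simp
        target' := by ext; simp }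
    have h1 := hF (p.map γ.continuous) fun r => hball (by
      show dist (p r) s < ε
      exact (hmem r).1)
    have h2 := F.map_eq_integral γ.toContinuousMap p
    have h3 := F.integral_add γ.toContinuousMap 0 s t
    have h4 : F.integral γ.toContinuousMap s t = ψ (γ t) - ψ (γ s) := by
      rw [← h2]; exact h1
    rw [← h3, h4]
    abel
  have h01 := key.apply_eq_of_isPreconnected isPreconnected_univ (Set.mem_univ (0 : I))
    (Set.mem_univ 1)
  simp only [integral_self, Path.source, Path.target, ← eq_integral] at h01
  rw [eq_sub_iff_add_eq, ← sub_eq_zero]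
  rw [zero_sub, eq_sub_iff_add_eq] at h01
  rw [← h01]; abel

/-- The value of a path cocycle on a path in a set that contracts to a point. -/
theorem eq_sub_of_contraction {U : Set X} {y : X} (H : C(U × I, X))
    (h0 : ∀ u, H (u, 0) = u) (h1 : ∀ u, H (u, 1) = y) {a b : X} (γ : Path a b)
    (hγ : ∀ t, γ t ∈ U) (ha : a ∈ U) (hb : b ∈ U) :
    F.toFun γ = F.integral (H.comp (ContinuousMap.prodMk (.const _ ⟨a, ha⟩) (.id I))) 0 1 -
      F.integral (H.comp (ContinuousMap.prodMk (.const _ ⟨b, hb⟩) (.id I))) 0 1 := by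
  let g : C(I, U) := ⟨fun t => ⟨γ t, hγ t⟩, by fun_prop⟩
  -- Contracting the whole path gives a map of the simply connected square: `γ` is one side, the
  -- tracks of `a` and `b` are the adjacent sides, and the remaining side is constant at `y`.
  let G : C(I × I, X) := H.comp (g.prodMap (.id I))
  have e1 : F.toFun γ = F.integral G (0, 0) (1, 0) := by
    rw [eq_integral]
    refine F.integral_congr _ idPath
      (idPath.prod (Path.refl 0)) fun t => ?_
    exact (h0 (g t)).symm
  have e2 : F.integral G (0, 1) (1, 1) = 0 := by
    rw [← F.map_eq_integral G (idPath.prod (Path.refl 1))]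
    exact F.eq_zero_of_const (y := y) fun t => h1 _
  have e3 : F.integral (H.comp (ContinuousMap.prodMk (.const _ ⟨a, ha⟩) (.id I))) 0 1 =
      F.integral G (0, 0) (0, 1) := by
    refine F.integral_congr _ idPath ((Path.refl 0).prod idPath) fun t => ?_
    have : g 0 = ⟨a, ha⟩ := Subtype.ext γ.source
    show _ = H (g 0, t)
    rw [this]; rfl
  have e4 : F.integral (H.comp (ContinuousMap.prodMk (.const _ ⟨b, hb⟩) (.id I))) 0 1 =
      F.integral G (1, 0) (1, 1) := by
    refine F.integral_congr _ idPath ((Path.refl 1).prod idPath) fun t => ?_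
    have : g 1 = ⟨b, hb⟩ := Subtype.ext γ.target
    show _ = H (g 1, t)
    rw [this]; rfl
  rw [e1, e3, e4, ← F.integral_add G (0, 0) (0, 1) (1, 0),
    ← F.integral_add G (0, 1) (1, 1) (1, 0), e2, zero_add, ← F.integral_neg G (1, 0)]
  abel

/-- The composition of a path cocycle with a homomorphism. -/
def comp {C : Type*} [AddCommGroup C] (f : B →+ C) : PathCocycle X C where
  toFun γ := f (F.toFun γ)
  map_trans γ δ := by rw [F.map_trans, map_add]
  map_homotopic h := by rw [F.map_homotopic h]

end PathCocycle

open Classical in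
/-- The path cocycle that sends a path to the homology class of the loop obtained by closing it up
with chosen paths from the base point. -/
def homologyCocycle {X : Type*} [TopologicalSpace X] (x : X) :
    PathCocycle X (Additive (Abelianization (FundamentalGroup X x))) where
  toFun {a b} γ := if h : Joined x a then
      Additive.ofMul (Abelianization.of
        (FundamentalGroup.fromPath (Path.Homotopic.Quotient.mk
          ((h.somePath.trans γ).trans (h.trans ⟨γ⟩).somePath.symm))))
    else 0
  map_trans {a b c} γ δ := by
    by_cases h : Joined x a
    · have hb : Joined x b := h.trans ⟨γ⟩
      -- Multiplication in the fundamental group traverses the right factor first, hence the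
      -- commutation.
      rw [dif_pos h, dif_pos h, dif_pos hb, add_comm, ← ofMul_mul, ← map_mul,
        FundamentalGroup.mul_def]
      congr 2
      simp only [Path.Homotopic.Quotient.mk_trans, Path.Homotopic.Quotient.mk_symm,
        Path.Homotopic.Quotient.trans_assoc]
      congr 2
      rw [← Path.Homotopic.Quotient.trans_assoc (Path.Homotopic.Quotient.symm _),
        Path.Homotopic.Quotient.symm_trans, Path.Homotopic.Quotient.refl_trans]
    · have hb : ¬ Joined x b := fun hb => h (hb.trans ⟨γ.symm⟩)
      rw [dif_neg h, dif_neg h, dif_neg hb, add_zero]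
  map_homotopic {a b γ δ} hγ := by
    by_cases h : Joined x a
    · rw [dif_pos h, dif_pos h]
      congr 3
      simp only [Path.Homotopic.Quotient.mk_trans, (Path.Homotopic.Quotient.eq).2 hγ]
    · rw [dif_neg h, dif_neg h]

/-- The closing-up path at the base point is itself a loop, so it only conjugates the class, which
the abelianization does not see. -/
theorem homologyCocycle_loop {X : Type*} [TopologicalSpace X] {x : X} (γ : Path x x) :
    (homologyCocycle x).toFun γ = Additive.ofMul (Abelianization.of
      (FundamentalGroup.fromPath (Path.Homotopic.Quotient.mk γ))) := by
  have h : Joined x x := Joined.refl x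
  let c : FundamentalGroup X x :=
    FundamentalGroup.fromPath (Path.Homotopic.Quotient.mk h.somePath)
  let g : FundamentalGroup X x := FundamentalGroup.fromPath (Path.Homotopic.Quotient.mk γ)
  have e : (homologyCocycle x).toFun γ = Additive.ofMul (Abelianization.of (c⁻¹ * (g * c))) :=
    dif_pos h
  have e' : Abelianization.of (c⁻¹ * (g * c)) = Abelianization.of g := by
    rw [map_mul, map_mul, mul_comm (Abelianization.of g), ← mul_assoc, ← map_mul, inv_mul_cancel,
      map_one, one_mul]
  rw [e, e']

theorem homologyCocycle_of_not_joined {X : Type*} [TopologicalSpace X] {x a b : X}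
    (h : ¬ Joined x a) (γ : Path a b) : (homologyCocycle x).toFun γ = 0 := dif_neg h

end

/-! ### Dimension counts and the parity of permutations. -/

noncomputable section

/-- The functions supported on `S` that are antisymmetric with respect to `α`. -/
def antisymmOn {D : Type*} (α : D → D) (S : Finset D) : Submodule ℚ (D → ℚ) where
  carrier := {c | (∀ d, c (α d) = -c d) ∧ ∀ d ∉ S, c d = 0}
  add_mem' := fun ha hb => ⟨fun d => by simp [ha.1 d, hb.1 d]; ring,
    fun d hd => by simp [ha.2 d hd, hb.2 d hd]⟩
  zero_mem' := ⟨fun d => by simp, fun d _ => rfl⟩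
  smul_mem' := fun r c hc => ⟨fun d => by simp [hc.1 d], fun d hd => by simp [hc.2 d hd]⟩

/-- An antisymmetric function is determined by its values on one element of each orbit of `α`; an
enumeration of `D` selects the smaller one. -/
theorem two_mul_finrank_antisymmOn_le {D : Type*} [Fintype D] (α : D → D)
    (hα : Function.Involutive α) (hfix : ∀ d, α d ≠ d) (S : Finset D) (hS : ∀ d ∈ S, α d ∈ S) :
    2 * Module.finrank ℚ (antisymmOn α S) ≤ S.card := by
  classical
  let e := Fintype.equivFin D
  let H := S.filter fun d => e d < e (α d)
  let H' := S.filter fun d => e (α d) < e d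
  have hcard : H.card = H'.card := by
    refine Finset.card_bij' (fun d _ => α d) (fun d _ => α d) ?_ ?_ ?_ ?_
    · intro d hd
      simp only [H, H', Finset.mem_filter] at hd ⊢
      exact ⟨hS d hd.1, by rw [hα d]; exact hd.2⟩
    · intro d hd
      simp only [H, H', Finset.mem_filter] at hd ⊢
      exact ⟨hS d hd.1, by rw [hα d]; exact hd.2⟩
    · intro d _; exact hα d
    · intro d _; exact hα d
  have hdisj : Disjoint H H' := by
    rw [Finset.disjoint_left]
    intro d h1 h2
    simp only [H, H', Finset.mem_filter] at h1 h2
    exact lt_asymm h1.2 h2.2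
  have hle : H.card + H'.card ≤ S.card := by
    rw [← Finset.card_union_of_disjoint hdisj]
    exact Finset.card_le_card (Finset.union_subset (Finset.filter_subset _ _)
      (Finset.filter_subset _ _))
  let r : antisymmOn α S →ₗ[ℚ] (H → ℚ) :=
    (LinearMap.funLeft ℚ ℚ (Subtype.val : H → D)).comp (antisymmOn α S).subtype
  have hr : Function.Injective r := by
    rw [← LinearMap.ker_eq_bot, LinearMap.ker_eq_bot']
    intro c hc
    have hH : ∀ d ∈ H, c.1 d = 0 := fun d hd => congrFun hc ⟨d, hd⟩
    ext d
    by_cases hd : d ∈ S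
    · rcases lt_trichotomy (e d) (e (α d)) with h | h | h
      · exact hH d (Finset.mem_filter.2 ⟨hd, h⟩)
      · exact absurd (e.injective h).symm (hfix d)
      · have := hH (α d) (Finset.mem_filter.2 ⟨hS d hd, by rwa [hα d]⟩)
        rw [c.2.1 d] at this
        simpa using this
    · exact c.2.2 d hd
  have := LinearMap.finrank_le_finrank_of_injective hr
  rw [Module.finrank_pi, Fintype.card_coe] at this
  omega

/-- The rank of an abelian group is the dimension of the dual of its rationalization. -/
theorem finrank_int_eq_finrank_dual (A : Type*) [AddCommGroup A] :
    Module.finrank ℤ A = Module.finrank ℚ (Module.Dual ℚ (TensorProduct ℤ ℚ A)) := by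
  rw [Subspace.dual_finrank_eq]
  exact ((TensorProduct.isBaseChange ℤ A ℚ).finrank_eq).symm

/-- The injection also supplies the finite dimensionality of `V`, without which `finrank` would be a
meaningless zero. -/
theorem finrank_add_card_le_of_injective {V ι D : Type*} [AddCommGroup V] [Module ℚ V] [Fintype ι]
    [Fintype D] (W : Submodule ℚ (D → ℚ)) (Ψ : V × (ι → ℚ) →ₗ[ℚ] W)
    (h : Function.Injective Ψ) :
    Module.finrank ℚ V + Fintype.card ι ≤ Module.finrank ℚ W := by
  have : Module.Finite ℚ (V × (ι → ℚ)) := Module.Finite.of_injective Ψ h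
  have : Module.Finite ℚ V := Module.Finite.of_surjective (LinearMap.fst ℚ V (ι → ℚ))
    LinearMap.fst_surjective
  have := LinearMap.finrank_le_finrank_of_injective h
  rwa [Module.finrank_prod, Module.finrank_pi] at this

/-- If the support of an even permutation `σ` has cardinality divisible by 4 and is preserved by
the fixed-point free involution `α`, then `σ * α` is not transitive on it. -/
theorem exists_invariant_ssubset {D : Type*} [Fintype D] [DecidableEq D] (σ α : Equiv.Perm D)
    (hσ : Equiv.Perm.sign σ = 1) (hα : ∀ d, α (α d) = d) (hfix : ∀ d, α d ≠ d)
    (hS : ∀ d, d ∈ σ.support ↔ α d ∈ σ.support) (hcard : 4 ∣ σ.support.card)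
    (hne : σ.support.Nonempty) :
    ∃ O ⊂ σ.support, O.Nonempty ∧ ∀ d, σ (α d) ∈ O ↔ d ∈ O := by
  by_contra hcon
  push Not at hcon
  have hO : ∀ O ⊆ σ.support, O.Nonempty → (∀ d, σ (α d) ∈ O ↔ d ∈ O) → O = σ.support := by
    intro O h1 h2 h3
    by_contra h4
    obtain ⟨d, hd⟩ := hcon O (Finset.ssubset_iff_subset_ne.2 ⟨h1, h4⟩) h2
    have := h3 d
    tauto
  -- On the support, `α` is a product of half as many transpositions as there are elements, an even
  -- number since 4 divides the cardinality.
  let α₀ : Equiv.Perm {d // d ∈ σ.support} := α.subtypePerm (fun d => (hS d).symm)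
  have hα₀ : Equiv.Perm.sign α₀ = 1 := by
    have h2 : α₀ ^ 2 = 1 := by
      ext d
      simp [α₀, pow_two, hα]
    rw [Equiv.Perm.sign_of_pow_two_eq_one h2]
    have hemp : IsEmpty (Function.fixedPoints α₀) := by
      refine ⟨fun d => hfix d.1.1 ?_⟩
      exact congrArg Subtype.val d.2
    rw [Fintype.card_eq_zero (α := Function.fixedPoints α₀), Fintype.card_coe]
    obtain ⟨m, hm⟩ := hcard
    rw [hm]
    have : (4 * m - 0) / 2 = 2 * m := by omega
    rw [this, pow_mul]; simp
  let φ : Equiv.Perm D := σ * Equiv.Perm.ofSubtype α₀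
  have hφ : Equiv.Perm.sign φ = 1 := by
    simp only [φ, map_mul, Equiv.Perm.sign_ofSubtype, hσ, hα₀, mul_one]
  have hφS : ∀ d ∈ σ.support, φ d = σ (α d) := by
    intro d hd
    simp only [φ, Equiv.Perm.mul_apply]
    rw [Equiv.Perm.ofSubtype_apply_of_mem _ hd]
    rfl
  have hφS' : ∀ d ∉ σ.support, φ d = d := by
    intro d hd
    simp only [φ, Equiv.Perm.mul_apply]
    rw [Equiv.Perm.ofSubtype_apply_of_not_mem _ hd]
    exact Equiv.Perm.notMem_support.1 hd
  have hmap : ∀ d, σ (α d) ∈ σ.support ↔ d ∈ σ.support := by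
    intro d
    rw [Equiv.Perm.apply_mem_support, hS d]
  have hsupp : φ.support = σ.support := by
    ext d
    rw [Equiv.Perm.mem_support]
    constructor
    · intro h
      by_contra hd
      exact h (hφS' d hd)
    · intro hd h
      rw [hφS d hd] at h
      have := hO {d} (by simpa using hd) ⟨d, by simp⟩ (by
        intro e
        simp only [Finset.mem_singleton]
        constructor
        · intro he
          exact α.injective (σ.injective (he.trans h.symm))
        · rintro rfl; exact h)
      rw [← this] at hcard
      simp at hcard
  obtain ⟨d₀, hd₀⟩ := hne
  have hcyc : φ.IsCycle := by
    refine ⟨d₀, ?_, ?_⟩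
    · rw [← Equiv.Perm.mem_support, hsupp]; exact hd₀
    · intro y hy
      rw [← Equiv.Perm.mem_support, hsupp] at hy
      have := hO (σ.support.filter fun y => φ.SameCycle d₀ y) (Finset.filter_subset _ _)
        ⟨d₀, Finset.mem_filter.2 ⟨hd₀, Equiv.Perm.SameCycle.refl _ _⟩⟩ (by
          intro e
          rw [Finset.mem_filter, Finset.mem_filter, hmap]
          refine and_congr_right fun he => ?_
          rw [← hφS e he, Equiv.Perm.sameCycle_apply_right])
      rw [← this] at hy
      exact (Finset.mem_filter.1 hy).2
  -- A transitive `φ` would be a cycle of length divisible by 4, hence odd, although both of its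
  -- factors are even.
  have hs := hcyc.sign
  rw [hφ, hsupp] at hs
  obtain ⟨m, hm⟩ := hcard
  rw [hm, pow_mul] at hs
  revert hs
  have : ((-1 : ℤˣ)) ^ 4 = 1 := by decide
  rw [this, one_pow]
  decide

end

/-! ### The oriented square in a tricolored pentachoron. -/

noncomputable section

/-- The standard coloring of the vertices of a tricolored pentachoron. -/
def pattern : Fin 5 → Fin 3 := ![0, 0, 1, 1, 2]

/-- The rotation of the square dual to the standard coloring. -/
def squareCycle : Equiv.Perm (Fin 5) where
  toFun := ![2, 3, 1, 0, 4]
  invFun := ![3, 2, 0, 1, 4]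
  left_inv := by decide
  right_inv := by decide

/-- `π` and `κ` identify a coloring of the vertices of a pentachoron with the standard one. -/
def IsLabeling (f : Fin 5 → Fin 3) (π : Equiv.Perm (Fin 5)) (κ : Equiv.Perm (Fin 3)) : Prop :=
  ∀ l, f (π l) = κ (pattern l)

/-- The rotation of the square in an oriented pentachoron with a labeling. -/
def squareRotation (u : ℤˣ) (π : Equiv.Perm (Fin 5)) (κ : Equiv.Perm (Fin 3)) : Equiv.Perm (Fin 5) :=
  π * squareCycle ^ ((Equiv.Perm.sign π * Equiv.Perm.sign κ * u : ℤˣ) : ℤ) * π⁻¹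

theorem sign_squareCycle : Equiv.Perm.sign squareCycle = -1 := by decide +kernel

/-- A symmetry of the standard coloring acts on the square as an element of the dihedral group;
whether it reverses the square is read off from its signs on vertices and colors. This is a finite
check. -/
theorem conj_squareCycle (ρ : Equiv.Perm (Fin 5)) (κ : Equiv.Perm (Fin 3))
    (h : ∀ l, pattern (ρ l) = κ (pattern l)) :
    ρ * squareCycle * ρ⁻¹ =
      squareCycle ^ ((Equiv.Perm.sign ρ * Equiv.Perm.sign κ : ℤˣ) : ℤ) := by
  revert ρ κ
  decide +kernel

theorem sign_squareRotation (u : ℤˣ) (π : Equiv.Perm (Fin 5)) (κ : Equiv.Perm (Fin 3)) :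
    Equiv.Perm.sign (squareRotation u π κ) = -1 := by
  have h := Int.units_eq_one_or (Equiv.Perm.sign π * Equiv.Perm.sign κ * u)
  rw [squareRotation, map_mul, map_mul, Equiv.Perm.sign_inv, mul_right_comm, Int.units_mul_self, one_mul]
  rcases h with h | h <;> rw [h] <;> simp [sign_squareCycle]

theorem squareRotation_apply (u : ℤˣ) (π : Equiv.Perm (Fin 5)) (κ : Equiv.Perm (Fin 3)) (l : Fin 5) :
    squareRotation u π κ (π l) =
      π ((squareCycle ^ ((Equiv.Perm.sign π * Equiv.Perm.sign κ * u : ℤˣ) : ℤ)) l) := by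
  simp [squareRotation]

theorem squareRotation_inv_apply (u : ℤˣ) (π : Equiv.Perm (Fin 5)) (κ : Equiv.Perm (Fin 3))
    (l : Fin 5) : (squareRotation u π κ)⁻¹ (π l) =
      π ((squareCycle ^ (-(Equiv.Perm.sign π * Equiv.Perm.sign κ * u : ℤˣ) : ℤ)) l) := by
  simp [squareRotation, mul_assoc]

theorem squareCycle_zpow_eq_self_iff (ε : ℤˣ) (l : Fin 5) :
    (squareCycle ^ (ε : ℤ)) l = l ↔ l = 4 := by
  rcases Int.units_eq_one_or ε with rfl | rfl <;> revert l <;> simp <;> decide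

/-- Two adjacent sides are opposite to vertices of different repeated colors, so every color
survives their removal. Thus adjacent sides meet in a corner. -/
theorem exists_pattern_eq (ε : ℤˣ) (l : Fin 5) (hl : l ≠ 4) (c : Fin 3) :
    ∃ m, m ≠ l ∧ m ≠ (squareCycle ^ (ε : ℤ)) l ∧ pattern m = c := by
  rcases Int.units_eq_one_or ε with rfl | rfl <;> revert l c <;> simp <;> decide

theorem squareRotation_eq_self_iff (u : ℤˣ) (π : Equiv.Perm (Fin 5)) (κ : Equiv.Perm (Fin 3))
    (k : Fin 5) : squareRotation u π κ k = k ↔ k = π 4 := by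
  obtain ⟨l, rfl⟩ := π.surjective k
  rw [squareRotation_apply, π.injective.eq_iff, π.injective.eq_iff, squareCycle_zpow_eq_self_iff]

theorem card_support_squareRotation (u : ℤˣ) (π : Equiv.Perm (Fin 5)) (κ : Equiv.Perm (Fin 3)) :
    (squareRotation u π κ).support.card = 4 := by
  have : (squareRotation u π κ).support = {π 4}ᶜ := by
    ext k
    rw [Equiv.Perm.mem_support, Ne, squareRotation_eq_self_iff]
    simp
  rw [this, Finset.card_compl]
  simp

namespace IsLabeling

variable {f : Fin 5 → Fin 3} {π π' : Equiv.Perm (Fin 5)} {κ κ' : Equiv.Perm (Fin 3)}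

/-- Two labelings differ by a symmetry of the coloring. The change of the exponent cancels the
inversion of `conj_squareCycle`, so the rotation depends only on the coloring and the orientation.
-/
theorem squareRotation_eq (h : IsLabeling f π κ) (h' : IsLabeling f π' κ') (u : ℤˣ) :
    squareRotation u π κ = squareRotation u π' κ' := by
  obtain ⟨ρ, rfl⟩ : ∃ ρ, π' = π * ρ := ⟨π⁻¹ * π', by simp⟩
  obtain ⟨κ₀, rfl⟩ : ∃ κ₀, κ' = κ * κ₀ := ⟨κ⁻¹ * κ', by simp⟩
  have hρ : ∀ l, pattern (ρ l) = κ₀ (pattern l) := fun l => κ.injective <| by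
    rw [← h (ρ l)]; exact h' l
  have hc := conj_squareCycle ρ κ₀ hρ
  have e : squareRotation u (π * ρ) (κ * κ₀) = π * (ρ * squareCycle * ρ⁻¹) ^
      ((Equiv.Perm.sign (π * ρ) * Equiv.Perm.sign (κ * κ₀) * u : ℤˣ) : ℤ) * π⁻¹ := by
    rw [conj_zpow, squareRotation]; group
  rw [e, hc, ← zpow_mul, ← Units.val_mul, squareRotation]
  congr 4
  rw [map_mul, map_mul]
  have h1 := Int.units_mul_self (Equiv.Perm.sign ρ)
  have h2 := Int.units_mul_self (Equiv.Perm.sign κ₀)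
  calc _ = Equiv.Perm.sign π * Equiv.Perm.sign κ * u *
        (Equiv.Perm.sign ρ * Equiv.Perm.sign ρ) * (Equiv.Perm.sign κ₀ * Equiv.Perm.sign κ₀) := by
        rw [h1, h2, mul_one, mul_one]
    _ = _ := by ac_rfl

/-- The symmetries of the coloring are transitive on the four sides, so a gluing needs to be studied
only along the side labeled 0. -/
theorem exists_apply_zero_eq (h : IsLabeling f π κ) {k : Fin 5} (hk : k ≠ π 4) :
    ∃ π' κ', IsLabeling f π' κ' ∧ π' 0 = k := by
  obtain ⟨l, rfl⟩ := π.surjective k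
  have hl : l ≠ 4 := fun e => hk (by rw [e])
  obtain ⟨ρ, κ₀, hρ, h0⟩ : ∃ (ρ : Equiv.Perm (Fin 5)) (κ₀ : Equiv.Perm (Fin 3)),
      (∀ m, pattern (ρ m) = κ₀ (pattern m)) ∧ ρ 0 = l := by
    fin_cases l
    · exact ⟨1, 1, by decide, by decide⟩
    · exact ⟨Equiv.swap 0 1, 1, by decide, by decide⟩
    · exact ⟨Equiv.swap 0 2 * Equiv.swap 1 3, Equiv.swap 0 1, by decide, by decide⟩
    · exact ⟨Equiv.swap 0 3 * Equiv.swap 1 2, Equiv.swap 0 1, by decide, by decide⟩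
    · exact absurd rfl hl
  refine ⟨π * ρ, κ * κ₀, fun m => ?_, by simp [h0]⟩
  simp only [Equiv.Perm.mul_apply, h (ρ m), hρ m]

theorem not_three (h : IsLabeling f π κ) {x y z : Fin 5} (hxy : x ≠ y) (hyz : y ≠ z)
    (hxz : x ≠ z) (h1 : f x = f y) (h2 : f y = f z) : False := by
  obtain ⟨x, rfl⟩ := π.surjective x
  obtain ⟨y, rfl⟩ := π.surjective y
  obtain ⟨z, rfl⟩ := π.surjective z
  rw [h, h, κ.injective.eq_iff] at h1 h2
  rw [Ne, π.injective.eq_iff] at hxy hyz hxz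
  have : ∀ x y z : Fin 5, pattern x = pattern y → pattern y = pattern z →
      x = y ∨ y = z ∨ x = z := by decide
  have := this x y z h1 h2
  tauto

theorem exists_eq_iff (h : IsLabeling f π κ) (k : Fin 5) :
    (∃ l, l ≠ k ∧ f l = f k) ↔ k ≠ π 4 := by
  obtain ⟨k, rfl⟩ := π.surjective k
  rw [Ne, π.injective.eq_iff]
  constructor
  · rintro ⟨l, hl, he⟩
    obtain ⟨l, rfl⟩ := π.surjective l
    rw [h, h, κ.injective.eq_iff] at he
    rw [Ne, π.injective.eq_iff] at hl
    revert k l; decide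
  · intro hk
    have : ∀ k : Fin 5, k ≠ 4 → ∃ l, l ≠ k ∧ pattern l = pattern k := by decide
    obtain ⟨l, hl, he⟩ := this k hk
    exact ⟨π l, by rwa [Ne, π.injective.eq_iff], by rw [h, h, he]⟩

theorem exists_color_eq (h : IsLabeling f π κ) (u : ℤˣ) {k : Fin 5}
    (hk : squareRotation u π κ k ≠ k) (c : Fin 3) :
    ∃ m, m ≠ k ∧ m ≠ squareRotation u π κ k ∧ f m = c := by
  rw [Ne, squareRotation_eq_self_iff] at hk
  obtain ⟨l, rfl⟩ := π.surjective k
  rw [π.injective.eq_iff] at hk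
  obtain ⟨m, h1, h2, h3⟩ := exists_pattern_eq _ l hk (κ⁻¹ c)
  refine ⟨π m, by rwa [Ne, π.injective.eq_iff], ?_, by rw [h, h3]; simp⟩
  rw [squareRotation_apply, Ne, π.injective.eq_iff]
  exact h2

/-- A labeling of one pentachoron is carried across the facet. Since the gluing reverses
orientation, the exponent changes sign. -/
theorem squareRotation_gluing {f' : Fin 5 → Fin 3} {g : Equiv.Perm (Fin 5)} {u u' : ℤˣ}
    (h : IsLabeling f π κ) (h' : IsLabeling f' π' κ')
    (hf : ∀ k, k ≠ π 0 → f' (g k) = f k) (hu : u' * Equiv.Perm.sign g * u = -1) :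
    squareRotation u' π' κ' (g (π 0)) = g ((squareRotation u π κ)⁻¹ (π 0)) := by
  have hf' : ∀ l, l ≠ 0 → f' (g (π l)) = κ (pattern l) := fun l hl => by
    rw [hf _ (by rwa [Ne, π.injective.eq_iff]), h]
  have hu' : u' * Equiv.Perm.sign g = -u := by
    calc _ = u' * Equiv.Perm.sign g * u * u := by rw [mul_assoc _ u u, Int.units_mul_self, mul_one]
      _ = -u := by rw [hu]; simp
  have hc : κ⁻¹ (f' (g (π 0))) = 0 ∨ κ⁻¹ (f' (g (π 0))) = 2 := by
    have h1 : κ⁻¹ (f' (g (π 0))) ≠ 1 := by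
      intro e
      rw [Equiv.Perm.inv_eq_iff_eq] at e
      refine h'.not_three (x := g (π 0)) (y := g (π 2)) (z := g (π 3)) ?_ ?_ ?_ ?_ ?_
      · simp
      · simp
      · simp
      · rw [e, hf' 2 (by decide)]; rfl
      · rw [hf' 2 (by decide), hf' 3 (by decide)]; rfl
    generalize κ⁻¹ (f' (g (π 0))) = c at h1 ⊢
    revert c; decide
  rw [squareRotation_inv_apply]
  rcases hc with hc | hc <;> rw [Equiv.Perm.inv_eq_iff_eq] at hc
  -- The vertex opposite to the facet has the same color on both sides, and the labeling carries
  -- over unchanged.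
  · have hl : IsLabeling f' (g * π) κ := by
      intro l
      by_cases h0 : l = 0
      · subst h0; exact hc
      · exact hf' l h0
    rw [h'.squareRotation_eq hl, show g (π 0) = (g * π) 0 from rfl, squareRotation_apply]
    have : Equiv.Perm.sign (g * π) * Equiv.Perm.sign κ * u' =
        -(Equiv.Perm.sign π * Equiv.Perm.sign κ * u) := by
      rw [map_mul, ← mul_neg, ← hu']; ac_rfl
    rw [this, Units.val_neg]
    rfl
  -- The new vertex has the previously single color, so colors 0 and 2 exchange roles. The
  -- transpositions of vertices and of colors contribute cancelling signs.
  · have hl : IsLabeling f' (g * π * Equiv.swap 1 4) (κ * Equiv.swap 0 2) := by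
      intro l
      fin_cases l
      · exact hc
      · exact hf' 4 (by decide)
      · exact hf' 2 (by decide)
      · exact hf' 3 (by decide)
      · exact hf' 1 (by decide)
    have e0 : g (π 0) = (g * π * Equiv.swap 1 4 : Equiv.Perm (Fin 5)) 0 := rfl
    rw [h'.squareRotation_eq hl, e0, squareRotation_apply]
    have : Equiv.Perm.sign (g * π * Equiv.swap 1 4) * Equiv.Perm.sign (κ * Equiv.swap 0 2) * u' =
        -(Equiv.Perm.sign π * Equiv.Perm.sign κ * u) := by
      rw [map_mul, map_mul, map_mul, Equiv.Perm.sign_swap (by decide),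
        Equiv.Perm.sign_swap (by decide), ← mul_neg, ← hu']
      simp only [mul_neg, mul_one, neg_mul, neg_neg]
      ac_rfl
    rw [this, Units.val_neg]
    simp only [Equiv.Perm.mul_apply]
    congr 2
    rcases Int.units_eq_one_or (Equiv.Perm.sign π * Equiv.Perm.sign κ * u) with e | e <;>
      rw [e] <;> simp <;> decide

end IsLabeling

theorem exists_isLabeling (f : Fin 5 → Fin 3)
    (h : ∃ c, (Finset.univ.filter fun k => f k = c).card = 1 ∧
      ∀ c', c' ≠ c → (Finset.univ.filter fun k => f k = c').card = 2) :
    ∃ π κ, IsLabeling f π κ := by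
  obtain ⟨c, h1, h2⟩ := h
  have key : ∀ c c' : Fin 3, (Finset.univ.filter fun l =>
      Equiv.swap 2 c (pattern l) = c').card = if c' = c then 1 else 2 := by decide
  have hcard : ∀ c' : Fin 3, Nonempty ({l // Equiv.swap 2 c (pattern l) = c'} ≃ {l // f l = c'}) := by
    intro c'
    refine ⟨Fintype.equivOfCardEq ?_⟩
    rw [Fintype.card_subtype, Fintype.card_subtype, key]
    split_ifs with hc
    · rw [hc, h1]
    · rw [h2 c' hc]
  let e := fun c' => Classical.choice (hcard c')
  exact ⟨Equiv.ofFiberEquiv e, Equiv.swap 2 c, fun l => Equiv.ofFiberEquiv_map e l⟩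

end

/-! ### The rotation system of the central surface. -/

noncomputable section

namespace SingularTriangulation

variable {n : ℕ} (T : SingularTriangulation n)

/-- The involution of the set of facets given by the face pairings. -/
def facetPairing : Equiv.Perm (Fin n × Fin 5) :=
  Function.Involutive.toPerm (fun d => (T.nbr d.1 d.2, T.glue d.1 d.2 d.2)) fun d => by
    simp [T.nbr_nbr, T.glue_glue]

theorem facetPairing_apply (d : Fin n × Fin 5) :
    T.facetPairing d = (T.nbr d.1 d.2, T.glue d.1 d.2 d.2) := rfl

theorem facetPairing_facetPairing (d : Fin n × Fin 5) :
    T.facetPairing (T.facetPairing d) = d := by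
  simp [facetPairing_apply, T.nbr_nbr, T.glue_glue]

theorem facetPairing_ne (d : Fin n × Fin 5) : T.facetPairing d ≠ d := T.ne_self d.1 d.2

/-- The `5n` facets are paired without fixed points, so `5n` is even. -/
theorem even_card (T : SingularTriangulation n) : Even n := by
  have h2 : T.facetPairing ^ 2 ^ 1 = 1 := by
    ext1 d
    simp only [pow_one, pow_two, Equiv.Perm.mul_apply, Equiv.Perm.one_apply]
    exact T.facetPairing_facetPairing d
  have hs := Equiv.Perm.card_compl_support_modEq (p := 2) (n := 1) h2
  have he : T.facetPairing.support = Finset.univ := by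
    ext d
    simp [T.facetPairing_ne d]
  rw [he, Finset.compl_univ, Finset.card_empty, Fintype.card_prod, Fintype.card_fin,
    Fintype.card_fin] at hs
  rw [Nat.even_iff]
  unfold Nat.ModEq at hs
  omega

namespace Tricoloring

variable {T} (P : T.Tricoloring)

/-- The colors of the vertices of a pentachoron. -/
def vertexColor (i : Fin n) (k : Fin 5) : Fin 3 := P.color (Quot.mk _ (i, k))

theorem vertexColor_glue {i : Fin n} {a k : Fin 5} (h : k ≠ a) :
    P.vertexColor (T.nbr i a) (T.glue i a k) = P.vertexColor i k := by
  unfold vertexColor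
  congr 1
  exact (Quot.sound ⟨a, h, rfl⟩).symm

/-- A labeling of the vertices of a pentachoron according to their colors. -/
def label (i : Fin n) : Equiv.Perm (Fin 5) :=
  (exists_isLabeling (P.vertexColor i) (P.two_two_one i)).choose

/-- The permutation of the colors that belongs to the labeling of a pentachoron. -/
def labelColor (i : Fin n) : Equiv.Perm (Fin 3) :=
  (exists_isLabeling (P.vertexColor i) (P.two_two_one i)).choose_spec.choose

theorem isLabeling (i : Fin n) : IsLabeling (P.vertexColor i) (P.label i) (P.labelColor i) :=
  (exists_isLabeling (P.vertexColor i) (P.two_two_one i)).choose_spec.choose_spec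

/-- The rotation of the sides of the square in which a pentachoron meets the central surface; a
side is denoted by the vertex opposite to the facet that contains it. -/
def rot (i : Fin n) : Equiv.Perm (Fin 5) :=
  squareRotation (T.ori i) (P.label i) (P.labelColor i)

/-- The rotation of the sides of all squares of the central surface. -/
def sideRotation : Equiv.Perm (Fin n × Fin 5) := Equiv.prodCongrRight P.rot

theorem sideRotation_apply (d : Fin n × Fin 5) : P.sideRotation d = (d.1, P.rot d.1 d.2) := rfl

theorem rot_eq_self_iff {i : Fin n} {k : Fin 5} :
    P.rot i k = k ↔ ∀ l, l ≠ k → P.vertexColor i l ≠ P.vertexColor i k := by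
  have h1 := squareRotation_eq_self_iff (T.ori i) (P.label i) (P.labelColor i) k
  have h2 := (P.isLabeling i).exists_eq_iff k
  rw [rot, h1, ← not_iff_not, ← Ne, ← h2]
  push Not
  rfl

/-- Coherence of the rotations: glued sides are traversed in opposite directions, so the predecessor
of a side in one square corresponds to the successor of the paired side in the other. -/
theorem rot_glue {i : Fin n} {k : Fin 5} (h : P.rot i k ≠ k) :
    P.rot (T.nbr i k) (T.glue i k k) = T.glue i k ((P.rot i)⁻¹ k) := by
  have h' := h
  rw [rot, Ne, squareRotation_eq_self_iff] at h'
  obtain ⟨π, κ, hl, h0⟩ := (P.isLabeling i).exists_apply_zero_eq h'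
  have := hl.squareRotation_gluing (u := T.ori i) (u' := T.ori (T.nbr i k)) (g := T.glue i k)
    (P.isLabeling (T.nbr i k)) (fun l hl => P.vertexColor_glue (h0 ▸ hl)) (T.ori_rev i k)
  rw [h0] at this
  rw [rot, rot, this, (P.isLabeling i).squareRotation_eq hl]

theorem rot_inv_ne {i : Fin n} {k : Fin 5} (h : P.rot i k ≠ k) : (P.rot i)⁻¹ k ≠ k := by
  rw [Ne, Equiv.Perm.inv_eq_iff_eq]
  exact fun e => h e.symm

theorem rot_glue_ne {i : Fin n} {k : Fin 5} (h : P.rot i k ≠ k) :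
    P.rot (T.nbr i k) (T.glue i k k) ≠ T.glue i k k := by
  rw [P.rot_glue h, Ne, (T.glue i k).injective.eq_iff]
  exact P.rot_inv_ne h

theorem rot_facetPairing_iff (d : Fin n × Fin 5) :
    P.rot (T.facetPairing d).1 (T.facetPairing d).2 ≠ (T.facetPairing d).2 ↔
      P.rot d.1 d.2 ≠ d.2 := by
  refine ⟨fun h => ?_, fun h => P.rot_glue_ne h⟩
  have := P.rot_glue_ne h
  have e := T.facetPairing_facetPairing d
  rw [facetPairing_apply (d := T.facetPairing d)] at e
  rw [Prod.ext_iff] at e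
  dsimp only at e
  rw [e.1, e.2] at this
  exact this

theorem exists_vertexColor_eq {i : Fin n} {k : Fin 5} (h : P.rot i k ≠ k) (c : Fin 3) :
    ∃ m, m ≠ k ∧ m ≠ P.rot i k ∧ P.vertexColor i m = c :=
  (P.isLabeling i).exists_color_eq (T.ori i) h c

theorem exists_vertexColor_eq' {i : Fin n} {k : Fin 5} (h : P.rot i k ≠ k) (c : Fin 3) :
    ∃ m, m ≠ k ∧ m ≠ (P.rot i)⁻¹ k ∧ P.vertexColor i m = c := by
  obtain ⟨m, h1, h2, h3⟩ := P.exists_vertexColor_eq (i := i) (k := (P.rot i)⁻¹ k)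
    (by simpa using (P.rot_inv_ne h).symm) c
  exact ⟨m, by simpa using h2, h1, h3⟩

theorem exists_rot_ne (i : Fin n) : ∃ k, P.rot i k ≠ k := by
  refine ⟨P.label i 0, ?_⟩
  rw [rot, Ne, squareRotation_eq_self_iff, (P.label i).injective.eq_iff]
  decide

/-- Each square contributes a 4-cycle, which is odd, and the number of squares is even. -/
theorem sign_sideRotation : Equiv.Perm.sign P.sideRotation = 1 := by
  rw [sideRotation, Equiv.Perm.sign_prodCongrRight]
  simp only [rot, sign_squareRotation, Finset.prod_const, Finset.card_univ, Fintype.card_fin]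
  exact T.even_card.neg_one_pow

theorem mem_support_sideRotation (d : Fin n × Fin 5) :
    d ∈ P.sideRotation.support ↔ P.rot d.1 d.2 ≠ d.2 := by
  rw [Equiv.Perm.mem_support, sideRotation_apply, Ne, Prod.ext_iff]
  simp

theorem card_sides (S : Finset (Fin n)) :
    (P.sideRotation.support.filter fun d => d.1 ∈ S).card = 4 * S.card := by
  have : (P.sideRotation.support.filter fun d => d.1 ∈ S) =
      (S.sigma fun i => (P.rot i).support).map
        (Equiv.sigmaEquivProd (Fin n) (Fin 5)).toEmbedding := by
    ext d
    rw [Finset.mem_map_equiv, Finset.mem_filter, mem_support_sideRotation]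
    simp [and_comm]
  rw [this, Finset.card_map, Finset.card_sigma, Finset.sum_congr rfl fun i _ =>
    show (P.rot i).support.card = 4 from card_support_squareRotation _ _ _]
  simp [mul_comm]

/-- The central surface has a proper set of sides of squares that is a union of the sets of sides
that start at the same vertex. -/
theorem exists_vertex_sides (hn : n ≠ 0) : ∃ O ⊂ P.sideRotation.support, O.Nonempty ∧
    ∀ d, P.sideRotation (T.facetPairing d) ∈ O ↔ d ∈ O := by
  have hcard := P.card_sides Finset.univ
  simp only [Finset.mem_univ, Finset.filter_true, Finset.card_univ, Fintype.card_fin] at hcard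
  refine exists_invariant_ssubset _ _ P.sign_sideRotation T.facetPairing_facetPairing
    T.facetPairing_ne (fun d => ?_) ⟨n, hcard⟩ ?_
  · rw [mem_support_sideRotation, mem_support_sideRotation, rot_facetPairing_iff]
  · rw [← Finset.card_pos]
    omega

/-! ### The squares as convex cells and their distinguished points. -/

/-- The square in which a pentachoron meets the central surface. -/
def cell (i : Fin n) : Set (Fin 5 → ℝ) :=
  {p | p ∈ stdSimplex ℝ (Fin 5) ∧ ∀ c, ∑ k, (if P.vertexColor i k = c then p k else 0) = 1 / 3}

theorem mem_cell_iff {i : Fin n} {p : Fin 5 → ℝ} (hp : p ∈ stdSimplex ℝ (Fin 5)) :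
    p ∈ P.cell i ↔ T.proj ⟨i, ⟨p, hp⟩⟩ ∈ P.centralSurface :=
  ⟨fun h => funext h.2, fun h => ⟨hp, fun c => congrFun h c⟩⟩

theorem convex_cell (i : Fin n) : Convex ℝ (P.cell i) := by
  refine (convex_stdSimplex ℝ (Fin 5)).inter ?_
  intro p hp q hq a b _ _ hab c
  have : ∀ k, (if P.vertexColor i k = c then (a • p + b • q) k else 0) =
      a * (if P.vertexColor i k = c then p k else 0) +
        b * (if P.vertexColor i k = c then q k else 0) := by
    intro k; split_ifs <;> simp
  rw [Finset.sum_congr rfl fun k _ => this k, Finset.sum_add_distrib, ← Finset.mul_sum,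
    ← Finset.mul_sum, hp c, hq c, ← add_mul, hab, one_mul]

theorem isCompact_cell (i : Fin n) : IsCompact (P.cell i) := by
  have hcl : IsClosed {p : Fin 5 → ℝ |
      ∀ c, ∑ k, (if P.vertexColor i k = c then p k else 0) = 1 / 3} := by
    rw [Set.ofPred_forall]
    refine isClosed_iInter fun c => isClosed_eq (continuous_finsetSum _ fun k _ => ?_)
      continuous_const
    split_ifs <;> fun_prop
  exact (isCompact_stdSimplex ℝ (Fin 5)).inter_right hcl

/-- At the vertex of the single color the coordinate is constantly `1 / 3`, so it cannot vanish. -/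
theorem rot_ne_of_apply_eq_zero {i : Fin n} {p : Fin 5 → ℝ} (hp : p ∈ P.cell i) {k : Fin 5}
    (hk : p k = 0) : P.rot i k ≠ k := by
  intro h
  rw [rot_eq_self_iff] at h
  have := hp.2 (P.vertexColor i k)
  rw [Finset.sum_eq_single k] at this
  · rw [if_pos rfl, hk] at this
    norm_num at this
  · intro l _ hl
    rw [if_neg (h l hl)]
  · simp

theorem pointRel_mem_cell_iff {i : Fin n} {a : Fin 5} {p q : Fin 5 → ℝ} (ha : p a = 0)
    (h : ∀ k, q (T.glue i a k) = p k) : p ∈ P.cell i ↔ q ∈ P.cell (T.nbr i a) := by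
  have hs : p ∈ stdSimplex ℝ (Fin 5) ↔ q ∈ stdSimplex ℝ (Fin 5) := by
    rw [stdSimplex, Set.mem_ofPred_eq, Set.mem_ofPred_eq, ← Equiv.sum_comp (T.glue i a) q,
      ← (T.glue i a).forall_congr_right (q := fun x => 0 ≤ q x)]
    simp only [h]
  by_cases hp : p ∈ stdSimplex ℝ (Fin 5)
  · rw [P.mem_cell_iff hp, P.mem_cell_iff (hs.1 hp),
      show T.proj ⟨i, ⟨p, hp⟩⟩ = T.proj ⟨T.nbr i a, ⟨q, hs.1 hp⟩⟩ from
        Quot.sound ⟨a, ha, rfl, h⟩]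
  · exact ⟨fun h => absurd h.1 hp, fun h => absurd (hs.2 h.1) hp⟩

/-- The point of a pentachoron that has the same barycentric coordinates at all vertices of the
same color in `B` and is mapped to the barycenter of the triangle. -/
def pointVal (i : Fin n) (B : Finset (Fin 5)) (k : Fin 5) : ℝ :=
  if k ∈ B then 1 / (3 * (B.filter fun l => P.vertexColor i l = P.vertexColor i k).card) else 0

theorem pointVal_mem_cell {i : Fin n} {B : Finset (Fin 5)}
    (hB : ∀ c, ∃ k ∈ B, P.vertexColor i k = c) : P.pointVal i B ∈ P.cell i := by
  have h1 : ∀ c, ∑ k, (if P.vertexColor i k = c then P.pointVal i B k else 0) = 1 / 3 := by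
    intro c
    have : ∀ k, (if P.vertexColor i k = c then P.pointVal i B k else 0) =
        if k ∈ B.filter (fun l => P.vertexColor i l = c) then
          1 / (3 * ((B.filter fun l => P.vertexColor i l = c).card : ℝ)) else 0 := by
      intro k
      simp only [Finset.mem_filter, pointVal]
      by_cases hc : P.vertexColor i k = c
      · subst hc; simp
      · simp [hc]
    rw [Finset.sum_congr rfl fun k _ => this k, Finset.sum_ite_mem, Finset.univ_inter,
      Finset.sum_const, nsmul_eq_mul]
    obtain ⟨k, hk, hc⟩ := hB c
    have hpos : 0 < (B.filter fun l => P.vertexColor i l = c).card :=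
      Finset.card_pos.2 ⟨k, Finset.mem_filter.2 ⟨hk, hc⟩⟩
    have : ((B.filter fun l => P.vertexColor i l = c).card : ℝ) ≠ 0 := by exact_mod_cast hpos.ne'
    field_simp
  refine ⟨⟨fun k => ?_, ?_⟩, h1⟩
  · rw [pointVal]; split_ifs <;> positivity
  · have h3 : ∑ c : Fin 3, ∑ k, (if P.vertexColor i k = c then P.pointVal i B k else 0) = 1 := by
      rw [Finset.sum_congr rfl fun c _ => h1 c]; simp
    rw [Finset.sum_comm] at h3
    simpa using h3

/-- The coordinates depend only on the colors within `B`, which the gluing preserves. Hence centers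
of sides and corners are matched with each other. -/
theorem pointVal_glue {i : Fin n} {a : Fin 5} {B : Finset (Fin 5)} (ha : a ∉ B) (k : Fin 5) :
    P.pointVal (T.nbr i a) (B.map (T.glue i a).toEmbedding) (T.glue i a k) = P.pointVal i B k := by
  unfold pointVal
  by_cases hk : k ∈ B
  · rw [if_pos hk, if_pos (by simpa using hk), Finset.filter_map, Finset.card_map]
    congr 4
    ext l
    rw [Finset.mem_filter, Finset.mem_filter]
    refine and_congr_right fun hl => ?_
    simp only [Function.comp_apply, Equiv.coe_toEmbedding]
    rw [P.vertexColor_glue (ne_of_mem_of_not_mem hl ha),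
      P.vertexColor_glue (ne_of_mem_of_not_mem hk ha)]
  · rw [if_neg hk, if_neg (by simpa using hk)]

theorem pointVal_apply_of_notMem {i : Fin n} {B : Finset (Fin 5)} {k : Fin 5} (hk : k ∉ B) :
    P.pointVal i B k = 0 := if_neg hk

open Classical in
/-- The point of a square of the central surface that belongs to a set of vertices. -/
def point (i : Fin n) (B : Finset (Fin 5)) : P.cell i :=
  if h : ∀ c, ∃ k ∈ B, P.vertexColor i k = c then ⟨P.pointVal i B, P.pointVal_mem_cell h⟩
  else ⟨P.pointVal i Finset.univ, P.pointVal_mem_cell fun c => by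
    obtain ⟨k, hk⟩ := P.exists_rot_ne i
    obtain ⟨m, -, -, hm⟩ := P.exists_vertexColor_eq hk c
    exact ⟨m, Finset.mem_univ _, hm⟩⟩

theorem coe_point {i : Fin n} {B : Finset (Fin 5)} (h : ∀ c, ∃ k ∈ B, P.vertexColor i k = c) :
    (P.point i B : Fin 5 → ℝ) = P.pointVal i B := by
  rw [point, dif_pos h]

instance (i : Fin n) : ContractibleSpace (P.cell i) :=
  (P.convex_cell i).contractibleSpace ⟨_, (P.point i ∅).2⟩

/-- The segment between two points of a square of the central surface. -/
def cellSegment {i : Fin n} (z w : P.cell i) : Path z w where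
  toFun t := ⟨AffineMap.lineMap (z : Fin 5 → ℝ) (w : Fin 5 → ℝ) (t : ℝ),
    (P.convex_cell i).segment_subset z.2 w.2
      (by rw [segment_eq_image_lineMap]; exact ⟨t, t.2, rfl⟩)⟩
  continuous_toFun := by
    refine Continuous.subtype_mk ?_ _
    exact AffineMap.lineMap_continuous.comp continuous_subtype_val
  source' := by ext; simp
  target' := by ext; simp

theorem cellSegment_apply {i : Fin n} (z w : P.cell i) (t : unitInterval) (k : Fin 5) :
    (P.cellSegment z w t : Fin 5 → ℝ) k =
      AffineMap.lineMap ((z : Fin 5 → ℝ) k) ((w : Fin 5 → ℝ) k) (t : ℝ) := by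
  simp [cellSegment, AffineMap.lineMap_apply]

end Tricoloring

end SingularTriangulation

end

/-! ### The topology of the surface as a quotient of its squares. -/

noncomputable section

open scoped unitInterval

namespace SingularTriangulation

namespace Tricoloring

variable {n : ℕ} {T : SingularTriangulation n} (P : T.Tricoloring)

/-- The disjoint union of the squares of the central surface. -/
def cells : Set (Fin n × (Fin 5 → ℝ)) := {u | u.2 ∈ P.cell u.1}

theorem isCompact_cells : IsCompact P.cells := by
  have : P.cells = ⋃ i : Fin n, {i} ×ˢ P.cell i := by
    ext u
    simp [cells]
  rw [this]
  exact isCompact_iUnion fun i => isCompact_singleton.prod (P.isCompact_cell i)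

instance : CompactSpace P.cells := isCompact_iff_compactSpace.1 P.isCompact_cells

/-- A point of a square as a point of the disjoint union. -/
def cellPoint (i : Fin n) (z : P.cell i) : P.cells := ⟨(i, z.1), z.2⟩

/-- The map from the disjoint union of the squares to the central surface. -/
def cellsProj (u : P.cells) : P.centralSurface :=
  ⟨T.proj ⟨u.1.1, ⟨u.1.2, u.2.1⟩⟩, (P.mem_cell_iff u.2.1).1 u.2⟩

theorem continuous_cellsProj : Continuous P.cellsProj := by
  refine Continuous.subtype_mk ?_ _
  have h1 : Continuous fun x : Fin n × stdSimplex ℝ (Fin 5) => (⟨x.1, x.2⟩ : Pentachora n) := by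
    rw [continuous_prod_of_discrete_left]
    exact fun i => @continuous_sigmaMk (Fin n) (fun _ => stdSimplex ℝ (Fin 5)) _ i
  have h2 : Continuous fun u : P.cells =>
      ((u.1.1, ⟨u.1.2, u.2.1⟩) : Fin n × stdSimplex ℝ (Fin 5)) := by
    refine Continuous.prodMk (by fun_prop) (Continuous.subtype_mk (by fun_prop) _)
  exact continuous_quot_mk.comp (h1.comp h2)

theorem surjective_cellsProj : Function.Surjective P.cellsProj := by
  rintro ⟨x, hx⟩
  obtain ⟨⟨i, p⟩, rfl⟩ := Quot.exists_rep x
  exact ⟨⟨(i, p.1), (P.mem_cell_iff p.2).2 hx⟩, rfl⟩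

/-- Identification of points of squares by the face pairings. -/
def Glued (u v : P.cells) : Prop :=
  ∃ k, u.1.2 k = 0 ∧ v.1.1 = T.nbr u.1.1 k ∧ ∀ l, v.1.2 (T.glue u.1.1 k l) = u.1.2 l

variable {P} in
theorem Glued.cellsProj_eq {u v : P.cells} (h : P.Glued u v) : P.cellsProj u = P.cellsProj v :=
  Subtype.ext (Quot.sound h)

open Classical in
/-- A function on the squares that is compatible with the face pairings descends to the central
surface. -/
theorem eq_of_cellsProj_eq {B : Type*} (ψ : P.cells → B) (hψ : ∀ u v, P.Glued u v → ψ u = ψ v)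
    {u v : P.cells} (h : P.cellsProj u = P.cellsProj v) : ψ u = ψ v := by
  -- The value `none` off the surface extends `ψ` to all pentachora, so that it descends to the
  -- realization.
  let φ : Pentachora n → Option B := fun p =>
    if h : (p.2 : Fin 5 → ℝ) ∈ P.cell p.1 then some (ψ ⟨(p.1, p.2), h⟩) else none
  have hφ : ∀ p q, T.PointRel p q → φ p = φ q := by
    rintro ⟨i, p⟩ ⟨j, q⟩ ⟨a, ha, hj, hq⟩
    dsimp only at ha hj hq
    subst hj
    have hiff := P.pointRel_mem_cell_iff ha hq
    by_cases hp : (p : Fin 5 → ℝ) ∈ P.cell i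
    · simp only [φ, dif_pos hp, dif_pos (hiff.1 hp)]
      rw [hψ ⟨(i, p), hp⟩ ⟨(T.nbr i a, q), hiff.1 hp⟩ ⟨a, ha, rfl, hq⟩]
    · simp only [φ, dif_neg hp, dif_neg fun h => hp (hiff.2 h)]
  have hl : Quot.lift φ hφ (P.cellsProj u).1 = Quot.lift φ hφ (P.cellsProj v).1 := by rw [h]
  have e : ∀ u : P.cells, Quot.lift φ hφ (P.cellsProj u).1 = some (ψ u) := fun u => by
    show φ _ = _
    exact dif_pos u.2
  rw [e, e] at hl
  exact Option.some_injective _ hl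

section Surface

variable {X : Type*} [TopologicalSpace X] (e : P.centralSurface ≃ₜ X)

/-- The map from a square to a space homeomorphic to the central surface. -/
def cellMap (i : Fin n) : C(P.cell i, X) where
  toFun z := e (P.cellsProj (P.cellPoint i z))
  continuous_toFun := by
    refine e.continuous.comp (P.continuous_cellsProj.comp (Continuous.subtype_mk ?_ _))
    fun_prop

variable {P} in
theorem cellMap_eq_of_glue {i : Fin n} {k : Fin 5} {z : P.cell i} {w : P.cell (T.nbr i k)}
    (hk : z.1 k = 0) (h : ∀ l, w.1 (T.glue i k l) = z.1 l) :
    P.cellMap e i z = P.cellMap e (T.nbr i k) w :=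
  congrArg e (Glued.cellsProj_eq ⟨k, hk, rfl, h⟩)

theorem exists_separation (s : Finset ℝ) :
    ∃ δ > 0, ∀ a ∈ s, ∀ b ∈ s, |a - b| < 2 * δ → a = b := by
  have : ∀ᶠ δ in nhdsWithin (0 : ℝ) (Set.Ioi 0), ∀ a ∈ s, ∀ b ∈ s, |a - b| < 2 * δ → a = b := by
    rw [Filter.eventually_all_finset]
    intro a _
    rw [Filter.eventually_all_finset]
    intro b _
    by_cases h : a = b
    · exact Filter.Eventually.of_forall fun _ _ => h
    · have hpos : 0 < |a - b| / 2 := by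
        have := abs_pos.2 (sub_ne_zero.2 h); positivity
      filter_upwards [nhdsWithin_le_nhds (Iio_mem_nhds hpos)] with δ hδ h'
      rw [Set.mem_Iio] at hδ
      linarith
  obtain ⟨δ, h1, h2⟩ := (this.and self_mem_nhdsWithin).exists
  exact ⟨δ, h2, h1⟩

open Classical in
/-- The point of `s` at distance less than `δ` from a given number, if there is one. -/
def roundTo (s : Finset ℝ) (δ : ℝ) (t : ℝ) : ℝ :=
  if h : ∃ a ∈ s, |t - a| < δ then h.choose else 0

theorem roundTo_eq {s : Finset ℝ} {δ : ℝ}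
    (h : ∀ a ∈ s, ∀ b ∈ s, |a - b| < 2 * δ → a = b) {a t : ℝ} (ha : a ∈ s) (ht : |t - a| < δ) :
    roundTo s δ t = a := by
  have hex : ∃ a ∈ s, |t - a| < δ := ⟨a, ha, ht⟩
  rw [roundTo, dif_pos hex]
  obtain ⟨h1, h2⟩ := hex.choose_spec
  refine h _ h1 _ ha ?_
  have := abs_sub_le hex.choose t a
  rw [abs_sub_comm] at h2
  linarith

theorem continuousAt_roundTo {s : Finset ℝ} {δ : ℝ}
    (h : ∀ a ∈ s, ∀ b ∈ s, |a - b| < 2 * δ → a = b) {a t : ℝ} (ha : a ∈ s) (ht : |t - a| < δ) :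
    ContinuousAt (roundTo s δ) t := by
  have hev : roundTo s δ =ᶠ[nhds t] fun _ => a := by
    have : ∀ᶠ x in nhds t, |x - a| < δ :=
      (continuous_abs.comp (continuous_sub_right a)).continuousAt.eventually_lt
        continuousAt_const ht
    filter_upwards [this] with x hx
    exact roundTo_eq h ha hx
  exact continuousAt_const.congr hev.symm

/-- Every point `y` of the central surface has an open neighborhood in each square of which the
points are rounded coordinatewise to a point that represents `y`. -/
theorem exists_rounding (y : P.centralSurface) :
    ∃ (r : ℝ → ℝ) (V : Set P.cells), r 0 = 0 ∧ IsOpen V ∧ (∀ u, P.cellsProj u = y → u ∈ V) ∧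
      (∀ u v, P.Glued u v → (u ∈ V ↔ v ∈ V)) ∧
      ∀ u ∈ V, (∀ k, ContinuousAt r (u.1.2 k)) ∧
        ∃ p : P.cell u.1.1, P.cellsProj (P.cellPoint u.1.1 p) = y ∧ ∀ k, r (u.1.2 k) = p.1 k := by
  obtain ⟨u₀, hu₀⟩ := P.surjective_cellsProj y
  -- Gluings permute coordinates, so all representatives of `y` have the same set of coordinate
  -- values. Including 0 makes the rounding preserve facets.
  let s : Finset ℝ := insert 0 (Finset.univ.image u₀.1.2)
  obtain ⟨δ, hδ, hs⟩ := exists_separation s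
  let r := roundTo s δ
  have hr0 : r 0 = 0 := roundTo_eq hs (by simp [s]) (by simpa using hδ)
  have hfib : ∀ u, P.cellsProj u = y → ∀ k, u.1.2 k ∈ s := by
    intro u hu k
    have hrange : Set.range u.1.2 = Set.range u₀.1.2 := by
      refine P.eq_of_cellsProj_eq (fun u => Set.range u.1.2) ?_ (hu.trans hu₀.symm)
      rintro u v ⟨k, -, -, h⟩
      rw [← (T.glue u.1.1 k).surjective.range_comp v.1.2]
      exact congrArg _ (funext fun l => (h l).symm)
    have : u.1.2 k ∈ Set.range u₀.1.2 := hrange ▸ Set.mem_range_self k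
    obtain ⟨l, hl⟩ := this
    rw [← hl]
    simp [s]
  have hround : ∀ i (x : Fin 5 → ℝ) (p : P.cell i), P.cellsProj (P.cellPoint i p) = y →
      (∀ k, |x k - p.1 k| < δ) → ∀ k, r (x k) = p.1 k :=
    fun i x p hp h k => roundTo_eq hs (hfib _ hp k) (h k)
  refine ⟨r, {u | ∃ p : P.cell u.1.1, P.cellsProj (P.cellPoint u.1.1 p) = y ∧
    ∀ k, |u.1.2 k - p.1 k| < δ}, hr0, ?_, ?_, ?_, ?_⟩
  · rw [isOpen_iff_mem_nhds]
    rintro u ⟨p, hp, h⟩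
    have h1 : ∀ᶠ v : P.cells in nhds u, v.1.1 = u.1.1 := by
      have : IsOpen ((fun v : P.cells => v.1.1) ⁻¹' {u.1.1}) :=
        (isOpen_discrete _).preimage (by fun_prop)
      exact this.mem_nhds rfl
    have h2 : ∀ᶠ v : P.cells in nhds u, ∀ k, |v.1.2 k - p.1 k| < δ := by
      rw [Filter.eventually_all]
      intro k
      refine ContinuousAt.eventually_lt (Continuous.continuousAt ?_) continuousAt_const (h k)
      fun_prop
    filter_upwards [h1, h2] with v hv1 hv2
    refine ⟨⟨p.1, by rw [hv1]; exact p.2⟩, ?_, hv2⟩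
    rw [← hp]
    congr 1
    exact Subtype.ext (Prod.ext hv1 rfl)
  · intro u hu
    exact ⟨⟨u.1.2, u.2⟩, hu, fun k => by simpa using hδ⟩
  · rintro ⟨⟨i, z⟩, hz⟩ ⟨⟨j, w⟩, hw⟩ ⟨k, hk, hj, h⟩
    dsimp only at hk hj h
    subst hj
    constructor
    · rintro ⟨p, hp, hd⟩
      dsimp only at p hp hd
      have hpk : p.1 k = 0 := by rw [← hround i z p hp hd k, hk, hr0]
      have hgl : ∀ l, (p.1 ∘ (T.glue i k).symm) (T.glue i k l) = p.1 l := fun l => by simp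
      have hmem := (P.pointRel_mem_cell_iff hpk hgl).1 p.2
      refine ⟨⟨_, hmem⟩, ?_, ?_⟩
      · rw [← hp]
        exact (Glued.cellsProj_eq (u := P.cellPoint i p) (v := P.cellPoint _ ⟨_, hmem⟩)
          ⟨k, hpk, rfl, hgl⟩).symm
      · dsimp only
        rw [← (T.glue i k).forall_congr_right
          (q := fun l => |w l - (p.1 ∘ (T.glue i k).symm) l| < δ)]
        intro l
        rw [h, hgl]
        exact hd l
    · rintro ⟨p, hp, hd⟩
      dsimp only at p hp hd
      have hpk : p.1 (T.glue i k k) = 0 := by rw [← hround _ w p hp hd _, h, hk, hr0]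
      have hgl : ∀ l, p.1 (T.glue i k l) = (p.1 ∘ T.glue i k) l := fun l => rfl
      have hmem : (p.1 ∘ T.glue i k) ∈ P.cell i :=
        (P.pointRel_mem_cell_iff (p := p.1 ∘ T.glue i k) hpk hgl).2 p.2
      refine ⟨⟨_, hmem⟩, ?_, ?_⟩
      · rw [← hp]
        exact Glued.cellsProj_eq (u := P.cellPoint _ ⟨_, hmem⟩) (v := P.cellPoint _ p)
          ⟨k, hpk, rfl, hgl⟩
      · intro l
        have := hd (T.glue i k l)
        rw [h] at this
        exact this
  · rintro u ⟨p, hp, hd⟩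
    exact ⟨fun k => continuousAt_roundTo hs (hfib _ hp k) (hd k), p, hp, hround _ _ p hp hd⟩

/-- Every point of the central surface has a neighborhood that contracts to it along segments in
squares. -/
theorem exists_star_neighborhood [T2Space X] (y : X) :
    ∃ U ∈ nhds y, ∃ H : C(U × I, X), (∀ u, H (u, 0) = u) ∧ (∀ u, H (u, 1) = y) ∧
      ∀ u, ∃ (i : Fin n) (z w : P.cell i), ∀ t, H (u, t) = P.cellMap e i (P.cellSegment z w t) := by
  obtain ⟨r, V, hr0, hVopen, hyV, hVsat, hV⟩ := P.exists_rounding (e.symm y)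
  let Q : P.cells → X := fun u => e (P.cellsProj u)
  have hQ : Continuous Q := e.continuous.comp P.continuous_cellsProj
  have hQs : Function.Surjective Q := e.surjective.comp P.surjective_cellsProj
  have hQe : ∀ {u v : P.cells}, Q u = Q v ↔ P.cellsProj u = P.cellsProj v := e.injective.eq_iff
  have hQprop : IsProperMap Q := hQ.isProperMap
  let U : Set X := {x | ∃ u ∈ V, Q u = x}
  have hUV : Q ⁻¹' U = V := by
    ext u
    constructor
    · rintro ⟨v, hv, hvu⟩
      exact (iff_of_eq (P.eq_of_cellsProj_eq (fun u => u ∈ V)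
        (fun u v h => propext (hVsat u v h)) (hQe.1 hvu))).1 hv
    · intro hu
      exact ⟨u, hu, rfl⟩
  have hUopen : IsOpen U := by
    rw [← (hQprop.isClosedMap.isQuotientMap hQ hQs).isOpen_preimage, hUV]
    exact hVopen
  have hyU : y ∈ U := by
    obtain ⟨u₀, hu₀⟩ := P.surjective_cellsProj (e.symm y)
    exact ⟨u₀, hyV u₀ hu₀, by simp [Q, hu₀]⟩
  have hround : ∀ u ∈ V, (fun k => r (u.1.2 k)) ∈ P.cell u.1.1 := by
    intro u hu
    obtain ⟨-, p, -, h⟩ := hV u hu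
    rw [show (fun k => r (u.1.2 k)) = p.1 from funext h]
    exact p.2
  let Z : ∀ u : V, P.cell u.1.1.1 := fun u => ⟨u.1.1.2, u.1.2⟩
  let R : ∀ u : V, P.cell u.1.1.1 := fun u => ⟨_, hround u.1 u.2⟩
  -- Points move straight to their rounding. As rounding acts on each coordinate separately and
  -- fixes 0, this is compatible with the gluings.
  let G : V × I → X := fun a => P.cellMap e a.1.1.1.1 (P.cellSegment (Z a.1) (R a.1) a.2)
  have hRy : ∀ u, P.cellMap e _ (R u) = y := by
    intro u
    obtain ⟨-, p, hp, h⟩ := hV u.1 u.2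
    rw [show R u = p from Subtype.ext (funext h)]
    exact (congrArg e hp).trans (e.apply_symm_apply y)
  have hG : Continuous G := by
    have hrc : ∀ k, Continuous fun a : V × I => r (a.1.1.1.2 k) := by
      intro k
      rw [continuous_iff_continuousAt]
      intro a
      refine ContinuousAt.comp (g := r) (f := fun a : V × I => a.1.1.1.2 k)
        ((hV a.1.1 a.1.2).1 k) ?_
      exact Continuous.continuousAt (by fun_prop)
    have hc : Continuous fun a : V × I =>
        P.cellPoint a.1.1.1.1 (P.cellSegment (Z a.1) (R a.1) a.2) := by
      refine Continuous.subtype_mk (Continuous.prodMk (by fun_prop) ?_) _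
      refine continuous_pi fun k => ?_
      have h1 : Continuous fun a : V × I => a.1.1.1.2 k := by fun_prop
      have h2 : Continuous fun a : V × I => (a.2 : ℝ) := by fun_prop
      have h3 := (h2.mul ((hrc k).sub h1)).add h1
      refine h3.congr fun a => ?_
      rw [cellSegment_apply, AffineMap.lineMap_apply]
      rfl
    exact hQ.comp hc
  have hGglue : ∀ (a b : P.cells) (ha : a ∈ V) (hb : b ∈ V), P.Glued a b →
      ∀ t, G (⟨a, ha⟩, t) = G (⟨b, hb⟩, t) := by
    rintro ⟨⟨i, z⟩, hz⟩ ⟨⟨j, w⟩, hw⟩ ha hb ⟨k, hk, hj, h⟩ t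
    dsimp only at hk hj h
    subst hj
    refine cellMap_eq_of_glue e (k := k) ?_ fun l => ?_
    · rw [cellSegment_apply]
      simp [Z, R, hk, hr0]
    · rw [cellSegment_apply, cellSegment_apply]
      simp [Z, R, h]
  have hGq : ∀ u v : V, Q u.1 = Q v.1 → ∀ t, G (u, t) = G (v, t) := by
    classical
    intro u v huv
    let g : P.cells → I → Option X := fun u t =>
      if h : u ∈ V then some (G (⟨u, h⟩, t)) else none
    have := P.eq_of_cellsProj_eq g ?_ (hQe.1 huv)
    · intro t
      have ht := congrFun this t
      simp only [g, dif_pos u.2, dif_pos v.2] at ht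
      exact Option.some_injective _ ht
    · intro a b hab
      funext t
      by_cases ha : a ∈ V
      · have hb : b ∈ V := (hVsat a b hab).1 ha
        simp only [g, dif_pos ha, dif_pos hb, hGglue a b ha hb hab t]
      · have hb : b ∉ V := fun hb => ha ((hVsat a b hab).2 hb)
        simp only [g, dif_neg ha, dif_neg hb]
  -- The quotient map from the compact union of squares to a Hausdorff space is proper, and this
  -- persists under restriction and product with `I`. So `q` is again a quotient map, and the
  -- contraction descends.
  let q : (Q ⁻¹' U) × I → U × I := Prod.map (U.restrictPreimage Q) id
  have hqprop : IsProperMap q := (hQprop.restrictPreimage U).prodMap isProperMap_id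
  have hex : ∀ x : U, ∃ u : Q ⁻¹' U, U.restrictPreimage Q u = x := by
    rintro ⟨x, hx⟩
    obtain ⟨u, rfl⟩ := hQs x
    exact ⟨⟨u, hx⟩, rfl⟩
  have hqs : Function.Surjective q := by
    rintro ⟨x, t⟩
    obtain ⟨u, rfl⟩ := hex x
    exact ⟨(u, t), rfl⟩
  have hqq : Topology.IsQuotientMap q := hqprop.isClosedMap.isQuotientMap hqprop.continuous hqs
  let ι : Q ⁻¹' U → V := Set.inclusion hUV.le
  let G' : C((Q ⁻¹' U) × I, X) := ⟨fun a => G (ι a.1, a.2),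
    hG.comp (((continuous_inclusion hUV.le).comp continuous_fst).prodMk continuous_snd)⟩
  let q' : C((Q ⁻¹' U) × I, U × I) := ⟨q, hqprop.continuous⟩
  have hfac : Function.FactorsThrough G' q' := by
    rintro ⟨u, t⟩ ⟨v, t'⟩ h
    obtain rfl : t = t' := congrArg Prod.snd h
    exact hGq (ι u) (ι v) (congrArg (fun x => (x.1 : X)) h) t
  let H : C(U × I, X) := Topology.IsQuotientMap.lift (f := q') hqq G' hfac
  have hH : ∀ u t, H (U.restrictPreimage Q u, t) = G (ι u, t) := fun u t =>
    congrArg (fun f => f (u, t)) (Topology.IsQuotientMap.lift_comp (f := q') hqq G' hfac)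
  refine ⟨U, hUopen.mem_nhds hyU, H, ?_, ?_, ?_⟩
  · intro x
    obtain ⟨u, rfl⟩ := hex x
    rw [hH]
    simp only [G, Path.source]
    rfl
  · intro x
    obtain ⟨u, rfl⟩ := hex x
    rw [hH]
    simp only [G, Path.target]
    exact hRy _
  · intro x
    obtain ⟨u, rfl⟩ := hex x
    exact ⟨_, Z (ι u), R (ι u), fun t => hH u t⟩

/-- A path cocycle on the central surface that is the difference of the values of a function on
each square is so globally, if the function is compatible with the face pairings. -/
theorem exists_primitive [T2Space X] {B : Type*} [AddCommGroup B] (F : PathCocycle X B)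
    (ψ : P.cells → B) (hψ : ∀ u v, P.Glued u v → ψ u = ψ v)
    (h : ∀ i (z w : P.cell i), F.integral (P.cellMap e i) z w =
      ψ (P.cellPoint i w) - ψ (P.cellPoint i z)) :
    ∃ φ : X → B, ∀ {a b : X} (γ : Path a b), F.toFun γ = φ b - φ a := by
  let φ : X → B := fun x => ψ (Function.surjInv P.surjective_cellsProj (e.symm x))
  have hφ : ∀ i (z : P.cell i), φ (P.cellMap e i z) = ψ (P.cellPoint i z) := by
    intro i z
    refine P.eq_of_cellsProj_eq ψ hψ ?_
    refine (Function.surjInv_eq P.surjective_cellsProj _).trans ?_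
    simp [cellMap]
  refine ⟨φ, fun γ => F.eq_sub_of_locally φ ?_ γ⟩
  intro y
  obtain ⟨U, hU, H, h0, h1, hH⟩ := P.exists_star_neighborhood e y
  refine ⟨U, hU, fun {a b} γ hγ => ?_⟩
  have ha : a ∈ U := by simpa using hγ 0
  have hb : b ∈ U := by simpa using hγ 1
  -- The track of each point stays in a single square, where the primitive is known.
  have key : ∀ x (hx : x ∈ U), F.integral (H.comp
      (ContinuousMap.prodMk (.const _ ⟨x, hx⟩) (.id I))) 0 1 = φ y - φ x := by
    intro x hx
    obtain ⟨i, z, w, hzw⟩ := hH ⟨x, hx⟩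
    rw [F.integral_congr (f' := P.cellMap e i) _ PathCocycle.idPath (P.cellSegment z w)
      (fun t => hzw t), h, ← hφ, ← hφ]
    congr 2
    · rw [← h1 ⟨x, hx⟩, hzw, Path.target]
    · have := h0 ⟨x, hx⟩
      rw [hzw, Path.source] at this
      exact this
  rw [F.eq_sub_of_contraction H h0 h1 γ hγ ha hb, key, key]
  abel

end Surface

end Tricoloring

end SingularTriangulation

end

/-! ### Integrals along the dual graph. -/

noncomputable section

namespace SingularTriangulation

namespace Tricoloring

variable {n : ℕ} {T : SingularTriangulation n} (P : T.Tricoloring)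

/-- The center of a square. -/
def center (i : Fin n) : P.cell i := P.point i Finset.univ

/-- The midpoint of a side of a square. -/
def sidePoint (d : Fin n × Fin 5) : P.cell d.1 := P.point d.1 {d.2}ᶜ

/-- The starting point of a side of a square. -/
def startPoint (d : Fin n × Fin 5) : P.cell d.1 := P.point d.1 {d.2, (P.rot d.1)⁻¹ d.2}ᶜ

/-- Gluing of a point of a square along the side opposite to `k` to a point of another square. -/
def GluedAlong {i : Fin n} (k : Fin 5) (z : P.cell i) (w : P.cell (T.nbr i k)) : Prop :=
  z.1 k = 0 ∧ ∀ l, w.1 (T.glue i k l) = z.1 l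

theorem gluedAlong_point {i : Fin n} {k : Fin 5} {B : Finset (Fin 5)} (hk : k ∉ B)
    (hB : ∀ c, ∃ k ∈ B, P.vertexColor i k = c) :
    P.GluedAlong k (P.point i B) (P.point (T.nbr i k) (B.map (T.glue i k).toEmbedding)) := by
  have hB' : ∀ c, ∃ l ∈ B.map (T.glue i k).toEmbedding, P.vertexColor (T.nbr i k) l = c := by
    intro c
    obtain ⟨l, hl, hc⟩ := hB c
    exact ⟨T.glue i k l, by simpa using hl, by
      rw [P.vertexColor_glue (ne_of_mem_of_not_mem hl hk), hc]⟩
  constructor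
  · rw [P.coe_point hB, P.pointVal_apply_of_notMem hk]
  · intro l
    rw [P.coe_point hB, P.coe_point hB', P.pointVal_glue hk]

theorem gluedAlong_sidePoint {i : Fin n} {k : Fin 5} (h : P.rot i k ≠ k) :
    P.GluedAlong k (P.sidePoint (i, k)) (P.sidePoint (T.facetPairing (i, k))) := by
  have := P.gluedAlong_point (i := i) (k := k) (B := {k}ᶜ) (by simp) fun c => by
    obtain ⟨m, h1, -, h3⟩ := P.exists_vertexColor_eq h c
    exact ⟨m, by simpa using h1, h3⟩
  have e : ({k}ᶜ : Finset (Fin 5)).map (T.glue i k).toEmbedding = {T.glue i k k}ᶜ := by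
    ext l; simp [Finset.mem_map_equiv, Equiv.symm_apply_eq]
  rw [e] at this
  exact this

/-- The start of a side is the end of the paired side, that is, the start of the side following it.
So `d` and `P.sideRotation (T.facetPairing d)` start at the same vertex of the surface. -/
theorem gluedAlong_startPoint {i : Fin n} {k : Fin 5} (h : P.rot i k ≠ k) :
    P.GluedAlong k (P.startPoint (i, k))
      (P.startPoint (P.sideRotation (T.facetPairing (i, k)))) := by
  have := P.gluedAlong_point (i := i) (k := k) (B := {k, (P.rot i)⁻¹ k}ᶜ) (by simp) fun c => by
    obtain ⟨m, h1, h2, h3⟩ := P.exists_vertexColor_eq' h c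
    exact ⟨m, by
      rw [Finset.mem_compl, Finset.mem_insert, Finset.mem_singleton, not_or]
      exact ⟨h1, h2⟩, h3⟩
  have e : ({k, (P.rot i)⁻¹ k}ᶜ : Finset (Fin 5)).map (T.glue i k).toEmbedding =
      {P.rot (T.nbr i k) (T.glue i k k),
        (P.rot (T.nbr i k))⁻¹ (P.rot (T.nbr i k) (T.glue i k k))}ᶜ := by
    rw [show (P.rot (T.nbr i k))⁻¹ (P.rot (T.nbr i k) (T.glue i k k)) = T.glue i k k by simp,
      P.rot_glue h]
    ext l
    simp only [Finset.mem_map_equiv, Finset.mem_compl, Finset.mem_insert, Finset.mem_singleton,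
      Equiv.symm_apply_eq, or_comm]
  rw [e] at this
  exact this

section Cocycle

variable {X : Type*} [TopologicalSpace X] (e : P.centralSurface ≃ₜ X) {B : Type*} [AddCommGroup B]
  (F : PathCocycle X B)

variable {P} in
theorem integral_eq_of_gluedAlong {i : Fin n} {k : Fin 5} {z w : P.cell i}
    {z' w' : P.cell (T.nbr i k)} (hz : P.GluedAlong k z z') (hw : P.GluedAlong k w w') :
    F.integral (P.cellMap e i) z w = F.integral (P.cellMap e (T.nbr i k)) z' w' := by
  refine F.integral_congr _ (P.cellSegment z w) (P.cellSegment z' w') fun t => ?_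
  refine cellMap_eq_of_glue e (k := k) ?_ fun l => ?_
  · rw [cellSegment_apply, hz.1, hw.1]
    simp
  · rw [cellSegment_apply, cellSegment_apply, hz.2, hw.2]

/-- The value of a path cocycle on a path from the center of a square to a point of it. -/
def centerIntegral {i : Fin n} (z : P.cell i) : B := F.integral (P.cellMap e i) (P.center i) z

/-- The value of a path cocycle on the path from the center of a square through the midpoint of
a side to the center of the adjacent square. -/
def sideIntegral (d : Fin n × Fin 5) : B :=
  P.centerIntegral e F (P.sidePoint d) - P.centerIntegral e F (P.sidePoint (T.facetPairing d))

theorem sideIntegral_facetPairing (d : Fin n × Fin 5) :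
    P.sideIntegral e F (T.facetPairing d) = -P.sideIntegral e F d := by
  rw [sideIntegral, sideIntegral, T.facetPairing_facetPairing, neg_sub]

/-- The path between the two centers may cross the common side at any point, because the detours
along the side in the two squares have the same image. -/
theorem sideIntegral_eq_of_gluedAlong {i : Fin n} {k : Fin 5} (h : P.rot i k ≠ k) {z : P.cell i}
    {w : P.cell (T.nbr i k)} (hz : P.GluedAlong k z w) :
    P.sideIntegral e F (i, k) = P.centerIntegral e F z - P.centerIntegral e F w := by
  have h1 := integral_eq_of_gluedAlong e F (P.gluedAlong_sidePoint h) hz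
  have h2 : P.centerIntegral e F (P.sidePoint (i, k)) + F.integral (P.cellMap e i) _ z =
      P.centerIntegral e F z := F.integral_add _ _ _ _
  have h3 : P.centerIntegral e F (P.sidePoint (T.facetPairing (i, k))) +
      F.integral (P.cellMap e (T.nbr i k)) _ w = P.centerIntegral e F w :=
    F.integral_add _ _ _ _
  rw [← h2, ← h3, h1, sideIntegral]
  abel

/-- Crossing at the starting corner writes the integral as a difference that telescopes around a
vertex. -/
theorem sideIntegral_eq_sub {d : Fin n × Fin 5} (h : P.rot d.1 d.2 ≠ d.2) :
    P.sideIntegral e F d = P.centerIntegral e F (P.startPoint d) -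
      P.centerIntegral e F (P.startPoint (P.sideRotation (T.facetPairing d))) :=
  P.sideIntegral_eq_of_gluedAlong e F h (P.gluedAlong_startPoint h)

theorem sideIntegral_comp {C : Type*} [AddCommGroup C] (f : B →+ C) (d : Fin n × Fin 5) :
    P.sideIntegral e (F.comp f) d = f (P.sideIntegral e F d) := by
  rw [sideIntegral, sideIntegral, map_sub]
  rfl

/-- A path cocycle vanishes on loops if its values on the edges of the dual graph are the
differences of the values of a function on the squares. -/
theorem eq_zero_of_sideIntegral_eq [T2Space X] (f : Fin n → B)
    (h : ∀ d, P.rot d.1 d.2 ≠ d.2 → P.sideIntegral e F d = f (T.facetPairing d).1 - f d.1)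
    {x : X} (γ : Path x x) : F.toFun γ = 0 := by
  -- The primitive is `f` at the center of a square, continued by integration within the square; the
  -- hypothesis is exactly its compatibility across sides.
  let ψ : P.cells → B := fun u => f u.1.1 + P.centerIntegral e F ⟨u.1.2, u.2⟩
  have hψ : ∀ u v, P.Glued u v → ψ u = ψ v := by
    rintro ⟨⟨i, z⟩, hz⟩ ⟨⟨j, w⟩, hw⟩ ⟨k, hk, hj, hg⟩
    dsimp only at hk hj hg
    subst hj
    have hk' := P.rot_ne_of_apply_eq_zero hz hk
    have h1 := P.sideIntegral_eq_of_gluedAlong e F hk' (z := ⟨z, hz⟩) (w := ⟨w, hw⟩) ⟨hk, hg⟩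
    rw [h (i, k) hk', sub_eq_sub_iff_add_eq_add] at h1
    show f i + P.centerIntegral e F ⟨z, hz⟩ = f (T.nbr i k) + P.centerIntegral e F ⟨w, hw⟩
    rw [add_comm, ← h1]
    rfl
  obtain ⟨φ, hφ⟩ := P.exists_primitive e F ψ hψ fun i z w => by
    have : P.centerIntegral e F z + F.integral (P.cellMap e i) z w = P.centerIntegral e F w :=
      F.integral_add _ _ _ _
    show _ = (f i + P.centerIntegral e F w) - (f i + P.centerIntegral e F z)
    rw [← this]
    abel
  rw [hφ, sub_self]

end Cocycle

/-! ### Components of the dual graph. -/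

/-- Two squares are adjacent if they have a common side. -/
def Adjacent (i j : Fin n) : Prop := ∃ k, P.rot i k ≠ k ∧ T.nbr i k = j

variable {P} in
theorem Adjacent.symm {i j : Fin n} (h : P.Adjacent i j) : P.Adjacent j i := by
  obtain ⟨k, hk, rfl⟩ := h
  exact ⟨T.glue i k k, P.rot_glue_ne hk, T.nbr_nbr i k⟩

open Classical in
/-- The squares that can be reached from a given one by passing to adjacent squares. -/
def component (i : Fin n) : Finset (Fin n) :=
  Finset.univ.filter fun j => Relation.ReflTransGen P.Adjacent i j

theorem mem_component {i j : Fin n} :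
    j ∈ P.component i ↔ Relation.ReflTransGen P.Adjacent i j := by simp [component]

theorem mem_component_self (i : Fin n) : i ∈ P.component i :=
  P.mem_component.2 .refl

theorem mem_component_iff_of_adjacent {i j j' : Fin n} (h : P.Adjacent j j') :
    j ∈ P.component i ↔ j' ∈ P.component i := by
  rw [mem_component, mem_component]
  exact ⟨fun h' => h'.tail h, fun h' => h'.tail h.symm⟩

theorem adjacent_facetPairing {d : Fin n × Fin 5} (h : P.rot d.1 d.2 ≠ d.2) :
    P.Adjacent d.1 (T.facetPairing d).1 := ⟨d.2, h, rfl⟩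

/-- The union of the squares of a component is clopen: its preimage is a union of whole squares that
is saturated for the gluings. -/
theorem not_joined {X : Type*} [TopologicalSpace X] [T2Space X] (e : P.centralSurface ≃ₜ X)
    {i j : Fin n} (hj : j ∉ P.component i) (z : P.cell i) (w : P.cell j) :
    ¬ Joined (P.cellMap e i z) (P.cellMap e j w) := by
  rintro ⟨γ⟩
  let Q : P.cells → X := fun u => e (P.cellsProj u)
  have hQ : Continuous Q := e.continuous.comp P.continuous_cellsProj
  have hQs : Function.Surjective Q := e.surjective.comp P.surjective_cellsProj
  have hq := hQ.isClosedMap.isQuotientMap hQ hQs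
  let A : Set X := {x | ∃ u : P.cells, u.1.1 ∈ P.component i ∧ Q u = x}
  have hinv : ∀ u v : P.cells, P.Glued u v →
      (u.1.1 ∈ P.component i) = (v.1.1 ∈ P.component i) := by
    rintro u v ⟨k, hk, hj, -⟩
    exact propext (P.mem_component_iff_of_adjacent
      ⟨k, P.rot_ne_of_apply_eq_zero u.2 hk, hj.symm⟩)
  have hA : Q ⁻¹' A = {u | u.1.1 ∈ P.component i} := by
    ext u
    constructor
    · rintro ⟨v, hv, hvu⟩
      exact (iff_of_eq (P.eq_of_cellsProj_eq _ hinv (e.injective hvu))).1 hv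
    · intro hu
      exact ⟨u, hu, rfl⟩
  have hclopen : IsClopen A := by
    have : IsClopen (Q ⁻¹' A) := by
      rw [hA]
      exact (isClopen_discrete (P.component i : Set (Fin n))).preimage (by fun_prop :
        Continuous fun u : P.cells => u.1.1)
    exact ⟨hq.isClosed_preimage.1 this.1, hq.isOpen_preimage.1 this.2⟩
  have hsub := (isPreconnected_range γ.continuous).subset_isClopen hclopen
    ⟨_, ⟨0, γ.source⟩, P.cellPoint i z, P.mem_component_self i, rfl⟩
  have hw : P.cellPoint j w ∈ Q ⁻¹' A := hsub ⟨1, γ.target⟩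
  rw [hA] at hw
  exact hj hw

/-- The sides of the squares in a component. -/
def componentSides (i : Fin n) : Finset (Fin n × Fin 5) :=
  P.sideRotation.support.filter fun d => d.1 ∈ P.component i

theorem mem_componentSides {i : Fin n} {d : Fin n × Fin 5} :
    d ∈ P.componentSides i ↔ P.rot d.1 d.2 ≠ d.2 ∧ d.1 ∈ P.component i := by
  rw [componentSides, Finset.mem_filter, mem_support_sideRotation]

theorem facetPairing_mem_componentSides {i : Fin n} {d : Fin n × Fin 5} :
    T.facetPairing d ∈ P.componentSides i ↔ d ∈ P.componentSides i := by
  rw [mem_componentSides, mem_componentSides, rot_facetPairing_iff]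
  exact and_congr_right fun h =>
    (P.mem_component_iff_of_adjacent (P.adjacent_facetPairing h)).symm

theorem exists_rot_pow_eq {i : Fin n} {k l : Fin 5} (hk : P.rot i k ≠ k) (hl : P.rot i l ≠ l) :
    ∃ m : ℕ, (P.rot i ^ m) k = l := by
  have key : ∀ (ε : ℤˣ) (k l : Fin 5), k ≠ 4 → l ≠ 4 →
      ∃ m : Fin 4, ((squareCycle ^ (ε : ℤ)) ^ (m : ℕ)) k = l := by
    intro ε
    rcases Int.units_eq_one_or ε with rfl | rfl <;> simp <;> decide
  obtain ⟨k, rfl⟩ := (P.label i).surjective k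
  obtain ⟨l, rfl⟩ := (P.label i).surjective l
  rw [rot, Ne, squareRotation_eq_self_iff, (P.label i).injective.eq_iff] at hk hl
  obtain ⟨m, hm⟩ := key (Equiv.Perm.sign (P.label i) * Equiv.Perm.sign (P.labelColor i) * T.ori i)
    k l hk hl
  refine ⟨m, ?_⟩
  rw [rot, squareRotation, conj_pow]
  simp [← hm]

/-- A nonempty set of sides that is closed under rotations and face pairings contains all sides,
if the central surface is connected. -/
theorem mem_of_closed {i : Fin n} (hi : P.component i = Finset.univ) {O : Finset (Fin n × Fin 5)}
    (hne : O.Nonempty) (hO : O ⊆ P.sideRotation.support)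
    (hrot : ∀ d ∈ O, P.sideRotation d ∈ O) (hpair : ∀ d ∈ O, T.facetPairing d ∈ O)
    {d : Fin n × Fin 5} (hd : P.rot d.1 d.2 ≠ d.2) : d ∈ O := by
  have hsquare : ∀ j k, (j, k) ∈ O → ∀ l, P.rot j l ≠ l → (j, l) ∈ O := by
    intro j k hk l hl
    obtain ⟨m, rfl⟩ := P.exists_rot_pow_eq ((P.mem_support_sideRotation _).1 (hO hk)) hl
    clear hl
    induction m with
    | zero => exact hk
    | succ m ih =>
      rw [pow_succ']
      exact hrot _ ih
  have hadj : ∀ j j', P.Adjacent j j' → (∀ l, P.rot j l ≠ l → (j, l) ∈ O) →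
      ∀ l, P.rot j' l ≠ l → (j', l) ∈ O := by
    rintro j _ ⟨k, hk, rfl⟩ h
    exact hsquare _ _ (hpair _ (h k hk))
  have hcomp : ∀ j, (∀ l, P.rot j l ≠ l → (j, l) ∈ O) ↔
      (∀ l, P.rot i l ≠ l → (i, l) ∈ O) := by
    intro j
    have hj : Relation.ReflTransGen P.Adjacent i j := by
      rw [← mem_component, hi]; exact Finset.mem_univ j
    induction hj with
    | refl => exact Iff.rfl
    | tail _ h ih => exact Iff.trans ⟨hadj _ _ h.symm, hadj _ _ h⟩ ih
  obtain ⟨⟨j, k⟩, hjk⟩ := hne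
  exact (hcomp d.1).2 ((hcomp j).1 (hsquare j k hjk)) d.2 hd

open Classical in
/-- The extension by zero of a function on the squares of a component other than the given
one. -/
def extendZero (i : Fin n) :
    ({j // j ∈ (P.component i).erase i} → ℚ) →ₗ[ℚ] (Fin n → ℚ) where
  toFun f j := if h : j ∈ (P.component i).erase i then f ⟨j, h⟩ else 0
  map_add' f g := by
    funext j
    by_cases h : j ∈ (P.component i).erase i <;> simp only [Pi.add_apply, h, dite_true, dite_false,
      add_zero]
  map_smul' r f := by
    funext j
    by_cases h : j ∈ (P.component i).erase i <;> simp only [Pi.smul_apply, h, dite_true, dite_false,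
      smul_zero, RingHom.id_apply]

theorem extendZero_of_notMem {i j : Fin n} (f) (h : j ∉ (P.component i).erase i) :
    P.extendZero i f j = 0 := dif_neg h

theorem extendZero_of_mem {i : Fin n} (f) (j : {j // j ∈ (P.component i).erase i}) :
    P.extendZero i f j = f j := dif_pos j.2

/-! ### The bound on the rank of the homology. -/

section Homology

variable {X : Type*} [TopologicalSpace X] (e : P.centralSurface ≃ₜ X)

/-- The additive map on homology classes that is given by a linear form on the rationalization. -/
def dualHom {A : Type*} [AddCommGroup A] (ρ : Module.Dual ℚ (TensorProduct ℤ ℚ A)) : A →+ ℚ :=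
  ρ.toAddMonoidHom.comp (TensorProduct.mk ℤ ℚ A 1).toAddMonoidHom

theorem dualHom_apply {A : Type*} [AddCommGroup A] (ρ : Module.Dual ℚ (TensorProduct ℤ ℚ A))
    (a : A) : dualHom ρ a = ρ (TensorProduct.tmul ℤ 1 a) := rfl

open Classical in
/-- The cochain on the dual graph of a component given by a linear form on the rational homology
and a function on the squares. -/
def dualCochain (x : X) (i : Fin n) :
    (Module.Dual ℚ (TensorProduct ℤ ℚ (Additive (Abelianization (FundamentalGroup X x)))) ×
      ({j // j ∈ (P.component i).erase i} → ℚ)) →ₗ[ℚ] (Fin n × Fin 5 → ℚ) where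
  toFun a d := if d ∈ P.componentSides i then
      dualHom a.1 (P.sideIntegral e (homologyCocycle x) d) -
        (P.extendZero i a.2 (T.facetPairing d).1 - P.extendZero i a.2 d.1)
    else 0
  map_add' a b := by
    funext d
    simp only [Pi.add_apply, Prod.fst_add, Prod.snd_add, map_add, dualHom_apply,
      LinearMap.add_apply]
    split_ifs <;> ring
  map_smul' r a := by
    funext d
    simp only [Pi.smul_apply, Prod.smul_fst, Prod.smul_snd, map_smul, dualHom_apply,
      LinearMap.smul_apply, smul_eq_mul, RingHom.id_apply]
    split_ifs <;> ring

theorem dualCochain_apply {x : X} {i : Fin n} {d : Fin n × Fin 5} (hd : d ∈ P.componentSides i)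
    (a) : P.dualCochain e x i a d = dualHom a.1 (P.sideIntegral e (homologyCocycle x) d) -
        (P.extendZero i a.2 (T.facetPairing d).1 - P.extendZero i a.2 d.1) := if_pos hd

theorem dualCochain_mem_antisymmOn (x : X) (i : Fin n) (a) :
    P.dualCochain e x i a ∈ antisymmOn T.facetPairing (P.componentSides i) := by
  refine ⟨fun d => ?_, fun d hd => if_neg hd⟩
  by_cases hd : d ∈ P.componentSides i
  · rw [P.dualCochain_apply e hd, P.dualCochain_apply e (P.facetPairing_mem_componentSides.2 hd),
      sideIntegral_facetPairing, T.facetPairing_facetPairing, map_neg]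
    ring
  · have hd' := mt P.facetPairing_mem_componentSides.1 hd
    have h1 : P.dualCochain e x i a d = 0 := if_neg hd
    have h2 : P.dualCochain e x i a (T.facetPairing d) = 0 := if_neg hd'
    rw [h1, h2, neg_zero]

/-- The classes of loops span the rationalized homology. -/
theorem dualHom_eq_zero {x : X}
    {ρ : Module.Dual ℚ (TensorProduct ℤ ℚ (Additive (Abelianization (FundamentalGroup X x))))}
    (h : ∀ γ : Path x x, ((homologyCocycle x).comp (dualHom ρ)).toFun γ = 0) : ρ = 0 := by
  refine LinearMap.ext fun t => ?_
  induction t with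
  | zero => simp
  | add t t' h h' => rw [map_add, h, h']; simp
  | tmul r a =>
    obtain ⟨g, rfl⟩ := Additive.ofMul.surjective a
    obtain ⟨g, rfl⟩ := QuotientGroup.mk_surjective g
    obtain ⟨γ, rfl⟩ := Path.Homotopic.Quotient.mk_surjective g
    have := h γ
    have h1 : ((homologyCocycle x).comp (dualHom ρ)).toFun γ =
        dualHom ρ ((homologyCocycle x).toFun γ) := rfl
    rw [h1, homologyCocycle_loop, dualHom_apply] at this
    have h2 : (TensorProduct.tmul ℤ r (Additive.ofMul (Abelianization.of
        (FundamentalGroup.fromPath (Path.Homotopic.Quotient.mk γ)))) : TensorProduct ℤ ℚ _) =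
        r • TensorProduct.tmul ℤ 1 (Additive.ofMul (Abelianization.of
        (FundamentalGroup.fromPath (Path.Homotopic.Quotient.mk γ)))) := by
      rw [TensorProduct.smul_tmul', smul_eq_mul, mul_one]
    show ρ (TensorProduct.tmul ℤ r (Additive.ofMul (Abelianization.of
        (FundamentalGroup.fromPath (Path.Homotopic.Quotient.mk γ))))) = 0
    rw [h2, map_smul, this, smul_zero]

/-- In the kernel, the side integrals are the coboundary of `f`, so the cocycle vanishes on loops
and `ρ = 0`. Then `f` is constant on the component, and it vanishes at the base square. On other
components the homology cocycle is zero by its default value. -/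
theorem injective_dualCochain [T2Space X] {i : Fin n} (z : P.cell i) :
    Function.Injective (P.dualCochain e (P.cellMap e i z) i) := by
  rw [← LinearMap.ker_eq_bot, LinearMap.ker_eq_bot']
  rintro ⟨ρ, f⟩ h
  have hd : ∀ d ∈ P.componentSides i,
      dualHom ρ (P.sideIntegral e (homologyCocycle (P.cellMap e i z)) d) =
        P.extendZero i f (T.facetPairing d).1 - P.extendZero i f d.1 := by
    intro d hd
    have := congrFun h d
    rw [P.dualCochain_apply e hd] at this
    exact sub_eq_zero.1 this
  have hcell : ∀ j ∉ P.component i, ∀ w w' : P.cell j,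
      (homologyCocycle (P.cellMap e i z)).integral (P.cellMap e j) w w' = 0 := fun j hj w w' =>
    homologyCocycle_of_not_joined (P.not_joined e hj z w) _
  have hρ : ρ = 0 := by
    refine dualHom_eq_zero fun γ => ?_
    refine P.eq_zero_of_sideIntegral_eq e _ (P.extendZero i f) (fun d hdr => ?_) γ
    rw [sideIntegral_comp]
    by_cases hdc : d.1 ∈ P.component i
    · exact hd d (P.mem_componentSides.2 ⟨hdr, hdc⟩)
    · have hdc' := mt (P.mem_component_iff_of_adjacent (P.adjacent_facetPairing hdr)).2 hdc
      rw [P.extendZero_of_notMem f (mt Finset.mem_of_mem_erase hdc),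
        P.extendZero_of_notMem f (mt Finset.mem_of_mem_erase hdc'), sideIntegral, centerIntegral,
        centerIntegral, hcell _ hdc, hcell _ hdc', sub_self, map_zero, sub_self]
  have hf : ∀ j ∈ P.component i, P.extendZero i f j = 0 := by
    intro j hj
    rw [mem_component] at hj
    induction hj with
    | refl => exact P.extendZero_of_notMem f (Finset.notMem_erase _ _)
    | @tail b c hb hc ih =>
      obtain ⟨k, hk, rfl⟩ := hc
      have := hd (b, k) (P.mem_componentSides.2 ⟨hk, P.mem_component.2 hb⟩)
      rw [hρ, ih, sub_zero] at this
      exact this.symm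
  refine Prod.ext hρ (funext fun j => ?_)
  refine (P.extendZero_of_mem f j).symm.trans ?_
  exact hf _ (Finset.mem_of_mem_erase j.2)

/-- The cocycle condition at the vertices in `O`: each term is `g d` minus `g` at the next side
around the same vertex, and this succession permutes `O`. -/
theorem sum_dualCochain_eq_zero {x : X} {i : Fin n} (hi : P.component i = Finset.univ)
    {O : Finset (Fin n × Fin 5)} (hO : O ⊆ P.sideRotation.support)
    (hO' : ∀ d, P.sideRotation (T.facetPairing d) ∈ O ↔ d ∈ O) (a) :
    ∑ d ∈ O, P.dualCochain e x i a d = 0 := by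
  let g : Fin n × Fin 5 → ℚ := fun d =>
    dualHom a.1 (P.centerIntegral e (homologyCocycle x) (P.startPoint d)) + P.extendZero i a.2 d.1
  have h1 : ∀ d ∈ O, P.dualCochain e x i a d =
      g d - g (P.sideRotation (T.facetPairing d)) := by
    intro d hd
    have hdr := (P.mem_support_sideRotation _).1 (hO hd)
    rw [P.dualCochain_apply e (P.mem_componentSides.2 ⟨hdr, hi ▸ Finset.mem_univ _⟩),
      P.sideIntegral_eq_sub e _ hdr, map_sub]
    simp only [g]
    have h2 : P.extendZero i a.2 (P.sideRotation (T.facetPairing d)).1 =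
        P.extendZero i a.2 (T.facetPairing d).1 := rfl
    rw [h2]
    ring
  rw [Finset.sum_congr rfl h1, Finset.sum_sub_distrib, sub_eq_zero]
  exact (Finset.sum_equiv (T.facetPairing.trans P.sideRotation) (fun d => (hO' d).symm)
    fun d _ => rfl).symm

/-- The rank of the first homology of the central surface is at most the number of squares. -/
theorem finrank_homology_le [T2Space X] (e : P.centralSurface ≃ₜ X) (x : X) :
    Module.finrank ℤ (Additive (Abelianization (FundamentalGroup X x))) ≤ n := by
  classical
  obtain ⟨i, z, rfl⟩ : ∃ i z, P.cellMap e i z = x := by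
    obtain ⟨u, hu⟩ := P.surjective_cellsProj (e.symm x)
    exact ⟨u.1.1, ⟨u.1.2, u.2⟩, by
      rw [← e.apply_symm_apply x, ← hu]; rfl⟩
  rw [finrank_int_eq_finrank_dual]
  have hinj := P.injective_dualCochain e z
  have hdim := two_mul_finrank_antisymmOn_le T.facetPairing T.facetPairing_facetPairing
    T.facetPairing_ne (P.componentSides i) fun d hd => P.facetPairing_mem_componentSides.2 hd
  have hcard : (P.componentSides i).card = 4 * (P.component i).card := P.card_sides _
  have hpos : 0 < (P.component i).card := Finset.card_pos.2 ⟨i, P.mem_component_self i⟩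
  have hι : Fintype.card {j // j ∈ (P.component i).erase i} = (P.component i).card - 1 := by
    rw [Fintype.card_coe, Finset.card_erase_of_mem (P.mem_component_self i)]
  by_cases hi : P.component i = Finset.univ
  · have hn : (P.component i).card = n := by rw [hi]; simp
    obtain ⟨O, hO, hne, hO'⟩ := P.exists_vertex_sides (by omega)
    let s : (Fin n × Fin 5 → ℚ) →ₗ[ℚ] ℚ := ∑ d ∈ O, LinearMap.proj d
    have hs : ∀ c, s c = ∑ d ∈ O, c d := fun c => by simp [s]
    let W := antisymmOn T.facetPairing (P.componentSides i) ⊓ LinearMap.ker s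
    have hlt : W < antisymmOn T.facetPairing (P.componentSides i) := by
      refine inf_le_left.lt_of_ne fun heq => ?_
      -- Otherwise `O` would be closed under the pairing, hence also under the rotation, and
      -- connectedness would make it the set of all sides.
      obtain ⟨d, hd, hd'⟩ : ∃ d ∈ O, T.facetPairing d ∉ O := by
        by_contra hcon
        push Not at hcon
        refine hO.2 fun d hd => P.mem_of_closed hi hne hO.1 (fun d hd => ?_) hcon
          ((P.mem_support_sideRotation d).1 hd)
        have := (hO' (T.facetPairing d)).2 (hcon d hd)
        rwa [T.facetPairing_facetPairing] at this
      have hdS : d ∈ P.componentSides i := P.mem_componentSides.2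
        ⟨(P.mem_support_sideRotation d).1 (hO.1 hd), hi ▸ Finset.mem_univ _⟩
      -- This antisymmetric function has sum 1 over `O`, so the condition at `O` is not automatic.
      let c : Fin n × Fin 5 → ℚ := Pi.single d 1 - Pi.single (T.facetPairing d) 1
      have hc : c ∈ antisymmOn T.facetPairing (P.componentSides i) := by
        constructor
        · intro d'
          have h1 : T.facetPairing d' = d ↔ d' = T.facetPairing d :=
            ⟨fun h => by rw [← h, T.facetPairing_facetPairing],
              fun h => by rw [h, T.facetPairing_facetPairing]⟩
          simp only [c, Pi.sub_apply, Pi.single_apply, h1, T.facetPairing.injective.eq_iff]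
          ring
        · intro d' hd'
          have h1 : d' ≠ d := fun h => hd' (h ▸ hdS)
          have h2 : d' ≠ T.facetPairing d := fun h =>
            hd' (h ▸ P.facetPairing_mem_componentSides.2 hdS)
          simp [c, h1, h2]
      have hc' : s c = 0 := by
        rw [← heq] at hc
        exact hc.2
      rw [hs] at hc'
      simp [c, Pi.single_apply, Finset.sum_sub_distrib, hd, hd'] at hc'
    have hfin := Submodule.finrank_lt_finrank_of_lt hlt
    have hle := finrank_add_card_le_of_injective W
      ((P.dualCochain e (P.cellMap e i z) i).codRestrict W fun a =>
        ⟨P.dualCochain_mem_antisymmOn e _ i a, by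
          rw [SetLike.mem_coe, LinearMap.mem_ker, hs]
          exact P.sum_dualCochain_eq_zero e hi hO.1 hO' a⟩)
      fun a b hab => hinj (congrArg Subtype.val hab)
    -- The rank plus `n - 1` is at most the dimension of `W`, which is at most `2n - 1`.
    omega
  · have hn : (P.component i).card < n := by
      have := Finset.card_lt_card (Finset.ssubset_univ_iff.2 hi)
      simpa using this
    have hle := finrank_add_card_le_of_injective
      (antisymmOn T.facetPairing (P.componentSides i))
      ((P.dualCochain e (P.cellMap e i z) i).codRestrict _
        (P.dualCochain_mem_antisymmOn e _ i))
      fun a b hab => hinj (congrArg Subtype.val hab)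
    -- The rank is at most one more than the size of the component, which is less than `n`.
    omega

end Homology

end Tricoloring

end SingularTriangulation

theorem mainTheorem4 {n : ℕ} (T : SingularTriangulation n)
    {M : Type*} [TopologicalSpace M] [T2Space M] [CompactSpace M]
    [ChartedSpace (EuclideanSpace ℝ (Fin 4)) M] (h : T.Realization ≃ₜ M)
    (P : T.Tricoloring) (hP : P.IsTS) (x : h '' P.centralSurface) :
    surfaceGenus (h '' P.centralSurface) x ≤ (n : ℚ) / 2 := by
  have := P.finrank_homology_le (h.image P.centralSurface) x
  rw [surfaceGenus]
  gcongr

end
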